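/- **Model.** Let $X_1,X_2,\dots$ be observations on a measurable space $(\Omega,\mathcal F)$, $\mathbf X^n=(X_1,\dots,X_n)$ and $\mathcal F_n=\sigma(X_1,\dots,X_n)$. Let $\Theta$ be a metric parameter space with distance $|u-\theta|$ and Borel $\sigma$-algebra (for example $\Theta\subseteq\mathbb R^p$). Let $\psi_i(x_i|\mathbf x^{i-1})$ and $f^{(\nu)}_{\theta,i}(x_i|\mathbf x^{i-1})$ be jointly measurable pre- and post-change conditional densities with respect to $\sigma$-finite measures. Under $\mathsf P_\infty$ the joint density of $\mathbf X^n$ is $\prod_{i=1}^n\psi_i(X_i|\mathbf X^{i-1})$. Under $\mathsf P_{\nu,\theta}$ ($\nu\in\mathbb Z_+=\{0,1,2,\dots\}$, $\theta\in\Theta$) it is $\prod_{i=1}^{\nu}\psi_i(X_i|\mathbf X^{i-1})\prod_{i=\nu+1}^n f^{(\nu)}_{\theta,i}(X_i|\mathbf X^{i-1})$ for $n>\nu$, and the same as under $\mathsf P_\infty$ for $n\le\nu$. Put $$Z^k_n(\theta)=\sum_{i=k+1}^n\log\frac{f^{(k)}_{\theta,i}(X_i|\mathbf X^{i-1})}{\psi_i(X_i|\mathbf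 X^{i-1})},\qquad R^W_n=\int_\Theta\sum_{k=1}^n\prod_{i=k}^n\frac{f^{(k-1)}_{\theta,i}(X_i|\mathbf X^{i-1})}{\psi_i(X_i|\mathbf X^{i-1})}\,dW(\theta),$$ where $W$ is a probability distribution on $\Theta$ with $W\{u:|u-\theta|<\delta\}>0$ for all $\theta\in\Theta$, $\delta>0$. The weighted Shiryaev--Roberts (WSR) procedure is $T_a=\inf\{n\ge1:\log R^W_n\ge a\}$ ($\inf\varnothing=\infty$). For a stopping time $\tau$ of $(\mathcal F_n)$ with values in $\mathbb Z_+\cup\{\infty\}$ let $$\mathcal R^q_{\nu,\theta}(\tau)=\mathsf E_{\nu,\theta}[(\tau-\nu)^q\mid\tau>\nu],\qquad \mathsf{PFA}_\varrho(\tau)=\sum_{k=0}^\infty\varrho(1-\varrho)^k\,\mathsf P_\infty(\tau\le k),$$ and let $\Delta(\alpha,\varrho)$ be the class of stopping times with $\mathsf{PFA}_\varrho(\tau)\le\alpha$. Write $b\sim c$ if $b/c\to1$. **Assumptions.** Let $r\ge1$ and let $I:\Theta\to(0,\infty)$, $\theta\mapsto I_\theta$, be continuous. $(\mathbf A_1)$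 For all $\theta\in\Theta$, $k\ge0$, $\varepsilon>0$: $\ \lim_{N\to\infty}\mathsf P_{k,\theta}\{\frac1N\max_{1\le n\le N}Z^k_{k+n}(\theta)\ge(1+\varepsilon)I_\theta\}=0$. $(\mathbf A_2(r))$ For all $\theta\in\Theta$, $\varepsilon>0$: $\ \lim_{\delta\to0}\sum_{n=1}^\infty n^{r-1}\sup_{\nu\ge0}\mathsf P_{\nu,\theta}\{\frac1n\inf_{|u-\theta|<\delta}Z^\nu_{\nu+n}(u)<I_\theta-\varepsilon\}<\infty$. Let $0<\varrho_\alpha<1$ ($0<\alpha<1$) satisfy $\varrho_\alpha\to0$ and $|\log\varrho_\alpha|/|\log\alpha|\to0$ as $\alpha\to0$. Write $\Delta(\alpha)=\Delta(\alpha,\varrho_\alpha)$ and $a^\circ_\alpha=\log\frac{1-\varrho_\alpha}{\varrho_\alpha\alpha}$. **Theorem.** One has $T_{a^\circ_\alpha}\in\Delta(\alpha)$ for every $0<\alpha<1$, and $a^\circ_\alpha\sim|\log\alpha|$ as $\alpha\to0$. Moreover, for every $q\in[1,r]$: (i) For all $\theta\in\Theta$ and $\nu\in\mathbb Z_+$,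 $\mathcal R^q_{\nu,\theta}(T_a)\sim(a/I_\theta)^q$ as $a\to\infty$. If $\mathsf{PFA}_{\varrho_\alpha}(T_{a_\alpha})\le\alpha$ for all sufficiently small $\alpha$ and $a_\alpha\sim|\log\alpha|$ as $\alpha\to0$ (in particular if $a_\alpha=a^\circ_\alpha$), then for all $\theta\in\Theta$ and $\nu\in\mathbb Z_+$, as $\alpha\to0$, $$\inf_{\tau\in\Delta(\alpha)}\mathcal R^q_{\nu,\theta}(\tau)\sim\Big(\frac{|\log\alpha|}{I_\theta}\Big)^q\sim\mathcal R^q_{\nu,\theta}(T_{a_\alpha}).$$ (ii) Let $k^*_\alpha\to\infty$ and $\alpha\varrho_\alpha k^*_\alpha\to0$ as $\alpha\to0$. If $a_\alpha=a^\circ_\alpha$, or more generally if $\mathsf{PFA}_{\varrho_\alpha}(T_{a_\alpha})\le\alpha$ for all sufficiently small $\alpha$, $a_\alpha\sim|\log\alpha|$ and $k^*_\alpha e^{-a_\alpha}\to0$, then for all $\theta\in\Theta$, as $\alpha\to0$, $$\inf_{\tau\in\Delta(\alpha)}\max_{0\le\nu\le k^*_\alpha}\mathcal R^q_{\nu,\theta}(\tau)\sim\Big(\frac{|\log\alpha|}{I_\theta}\Big)^q\sim\max_{0\le\nu\le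 k^*_\alpha}\mathcal R^q_{\nu,\theta}(T_{a_\alpha}).$$ -/

import Mathlib

open MeasureTheory ProbabilityTheory Filter Topology
open scoped NNReal ENNReal

/-- The first `i` entries of a vector of length `n`, where `i < n`. -/
def initialSegment {𝒳 : Type*} {n : ℕ} (x : Fin n → 𝒳) (i : Fin n) : Fin i → 𝒳 :=
  fun j => x (Fin.castLE i.isLt.le j)

/-- The product `∏_{i ≤ n} ψ_i(x_i | x^{i-1})` (joint density of the first `n` observations when
the change never occurs). -/
noncomputable def preChangeJointDensity {𝒳 : Type*}
    (ψ : (i : ℕ) → (Fin i → 𝒳) → 𝒳 → ℝ≥0) (n : ℕ) (x : Fin n → 𝒳) : ℝ≥0∞ :=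
  ∏ i : Fin n, (ψ i (initialSegment x i) (x i) : ℝ≥0∞)

/-- The product `∏_{i ≤ ν} ψ_i(x_i | x^{i-1}) ∏_{ν < i ≤ n} f_i(x_i | x^{i-1})` (joint density of
the first `n` observations when the change point is `ν`, so that the `ν`-th observation is the last
pre-change one).  For `n ≤ ν` all the factors are pre-change ones. -/
noncomputable def postChangeJointDensity {𝒳 : Type*}
    (ψ f : (i : ℕ) → (Fin i → 𝒳) → 𝒳 → ℝ≥0) (ν n : ℕ) (x : Fin n → 𝒳) : ℝ≥0∞ :=
  ∏ i : Fin n,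
    ((if (i : ℕ) < ν then ψ i (initialSegment x i) (x i)
      else f i (initialSegment x i) (x i) : ℝ≥0) : ℝ≥0∞)

/-- The general (non-i.i.d.) change-point model with parameter set `Θ`, sample space `Ω` and
observation space `𝒳`.

Observations are indexed from zero: `X i` is the `(i+1)`-th observation, `ψ i` is its pre-change
conditional density given the preceding `i` observations, and `f ν θ i` its post-change conditional
density given the preceding `i` observations; post-change densities may depend on the change
point `ν`.  Densities are taken with respect to the `σ`-finite measures `μ i`. That the products
in `law_Pinf` and `law_P` are the joint densities for all `n` is what makes the factors conditional
densities. -/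
structure ChangePointModel (Θ Ω 𝒳 : Type*) [MeasurableSpace Θ] [MeasurableSpace Ω]
    [MeasurableSpace 𝒳] where
  /-- the observations -/
  X : ℕ → Ω → 𝒳
  measurable_X : ∀ i, Measurable (X i)
  /-- the dominating measures -/
  μ : ℕ → Measure 𝒳
  sigmaFinite_μ : ∀ i, SigmaFinite (μ i)
  /-- the pre-change conditional densities -/
  ψ : (i : ℕ) → (Fin i → 𝒳) → 𝒳 → ℝ≥0
  measurable_ψ : ∀ i, Measurable (fun p : (Fin i → 𝒳) × 𝒳 => ψ i p.1 p.2)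
  /-- the post-change conditional densities -/
  f : ℕ → Θ → (i : ℕ) → (Fin i → 𝒳) → 𝒳 → ℝ≥0
  measurable_f : ∀ ν i, Measurable (fun p : Θ × (Fin i → 𝒳) × 𝒳 => f ν p.1 i p.2.1 p.2.2)
  /-- the distribution when there is no change -/
  Pinf : Measure Ω
  isProbabilityMeasure_Pinf : IsProbabilityMeasure Pinf
  law_Pinf : ∀ n : ℕ, Pinf.map (fun ω (i : Fin n) => X i ω) =
    (Measure.pi (fun i : Fin n => μ i)).withDensity (preChangeJointDensity ψ n)
  /-- the distribution when the change point is `ν` and the post-change parameter is `θ` -/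
  P : ℕ → Θ → Measure Ω
  isProbabilityMeasure_P : ∀ ν θ, IsProbabilityMeasure (P ν θ)
  law_P : ∀ (ν : ℕ) (θ : Θ) (n : ℕ), (P ν θ).map (fun ω (i : Fin n) => X i ω) =
    (Measure.pi (fun i : Fin n => μ i)).withDensity (postChangeJointDensity ψ (f ν θ) ν n)

namespace ChangePointModel

variable {Θ Ω 𝒳 : Type*} [MeasurableSpace Θ] [mΩ : MeasurableSpace Ω] [MeasurableSpace 𝒳]

/-- The vector of the first `n` observations. -/
def hist (M : ChangePointModel Θ Ω 𝒳) (n : ℕ) (ω : Ω) : Fin n → 𝒳 := fun i => M.X i ω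

theorem measurable_hist (M : ChangePointModel Θ Ω 𝒳) (n : ℕ) : Measurable (M.hist n) :=
  measurable_pi_lambda _ fun i => M.measurable_X i

/-- The filtration generated by the observations: `ℱ_n` is generated by the first `n` of them. -/
def obsFiltration (M : ChangePointModel Θ Ω 𝒳) : Filtration ℕ mΩ where
  seq n := MeasurableSpace.comap (M.hist n) inferInstance
  mono' := by
    intro n m hnm
    have h : M.hist n = (fun (x : Fin m → 𝒳) (i : Fin n) => x (Fin.castLE hnm i)) ∘ M.hist m := rfl
    have hm : Measurable (fun (x : Fin m → 𝒳) (i : Fin n) => x (Fin.castLE hnm i)) :=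
      measurable_pi_lambda _ fun i => measurable_pi_apply _
    change MeasurableSpace.comap (M.hist n) inferInstance ≤ _
    rw [h, ← MeasurableSpace.comap_comp]
    exact MeasurableSpace.comap_mono hm.comap_le
  le' n := (M.measurable_hist n).comap_le

/-- The likelihood ratio of the `(i+1)`-th observation given the preceding ones, for the change
point `ν` and the parameter `θ`.  It is computed in `[0, ∞]`, so that it is infinite where only the
pre-change density vanishes. -/
noncomputable def ratio (M : ChangePointModel Θ Ω 𝒳) (ν : ℕ) (θ : Θ) (i : ℕ) (ω : Ω) : ℝ≥0∞ :=
  (M.f ν θ i (M.hist i ω) (M.X i ω) : ℝ≥0∞) / (M.ψ i (M.hist i ω) (M.X i ω) : ℝ≥0∞)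

/-- The log-likelihood ratio `Z_n^k(θ)` of the hypotheses "change at `k` with parameter `θ`" and
"no change", based on the first `n` observations. -/
noncomputable def Z (M : ChangePointModel Θ Ω 𝒳) (k n : ℕ) (θ : Θ) (ω : Ω) : EReal :=
  ∑ i ∈ Finset.Ico k n, ENNReal.log (M.ratio k θ i ω)

/-- The Shiryaev–Roberts statistic `R_n(θ)` tuned to `θ`. -/
noncomputable def SR (M : ChangePointModel Θ Ω 𝒳) (n : ℕ) (θ : Θ) (ω : Ω) : ℝ≥0∞ :=
  ∑ k ∈ Finset.range n, ∏ i ∈ Finset.Ico k n, M.ratio k θ i ω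

/-- The weighted Shiryaev–Roberts statistic `R_n^W`. -/
noncomputable def WSR (M : ChangePointModel Θ Ω 𝒳) (W : Measure Θ) (n : ℕ) (ω : Ω) : ℝ≥0∞ :=
  ∫⁻ θ, M.SR n θ ω ∂W

/-- The weighted Shiryaev–Roberts procedure `T_a = inf {n ≥ 1 : log R_n^W ≥ a}`, with
`inf ∅ = ∞`. -/
noncomputable def T (M : ChangePointModel Θ Ω 𝒳) (W : Measure Θ) (a : ℝ) (ω : Ω) : ℕ∞ :=
  sInf {t : ℕ∞ | ∃ n : ℕ, t = n ∧ 1 ≤ n ∧ (a : EReal) ≤ ENNReal.log (M.WSR W n ω)}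

/-- The risk `E_{ν,θ}[(τ - ν)^r | τ > ν]`, with values in `[0, ∞]`. -/
noncomputable def risk (M : ChangePointModel Θ Ω 𝒳) (r : ℝ) (ν : ℕ) (θ : Θ) (τ : Ω → ℕ∞) : ℝ≥0∞ :=
  ∫⁻ ω, ((τ ω : ℝ≥0∞) - (ν : ℝ≥0∞)) ^ r ∂((M.P ν θ)[|{ω | (ν : ℕ∞) < τ ω}])

/-- The weighted probability of false alarm for the geometric prior with parameter `ϱ`. -/
noncomputable def PFA (M : ChangePointModel Θ Ω 𝒳) (ϱ : ℝ) (τ : Ω → ℕ∞) : ℝ≥0∞ :=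
  ∑' k : ℕ, ENNReal.ofReal (ϱ * (1 - ϱ) ^ k) * M.Pinf {ω | τ ω ≤ (k : ℕ∞)}

/-- The class `Δ(α, ϱ)` of stopping times whose weighted probability of false alarm is at
most `α`. -/
def Delta (M : ChangePointModel Θ Ω 𝒳) (α ϱ : ℝ) : Set (Ω → ℕ∞) :=
  {τ | IsStoppingTime M.obsFiltration τ ∧ M.PFA ϱ τ ≤ ENNReal.ofReal α}

/-- The right-tail condition `(A₁)`. -/
def RightTail (M : ChangePointModel Θ Ω 𝒳) (I : Θ → ℝ) : Prop :=
  ∀ (θ : Θ) (k : ℕ) (ε : ℝ), 0 < ε →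
    Tendsto (fun N : ℕ => M.P k θ {ω | (((1 + ε) * I θ : ℝ) : EReal) ≤
        (⨆ n ∈ Finset.Icc 1 N, M.Z k (k + n) θ ω) / (N : EReal)})
      atTop (𝓝 0)

end ChangePointModel

/-- The series `∑_{n ≥ 1} n^{r-1} sup_ν P_{ν,θ}(n⁻¹ inf_{|u-θ|<δ} Z_{ν+n}^ν(u) < I_θ - ε)`. -/
noncomputable def ChangePointModel.leftTailSeries {Θ Ω 𝒳 : Type*} [MetricSpace Θ]
    [MeasurableSpace Θ] [MeasurableSpace Ω] [MeasurableSpace 𝒳] (M : ChangePointModel Θ Ω 𝒳)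
    (I : Θ → ℝ) (r ε : ℝ) (θ : Θ) (δ : ℝ) : ℝ≥0∞ :=
  ∑' n : ℕ, ENNReal.ofReal (((n + 1 : ℕ) : ℝ) ^ (r - 1)) *
    ⨆ ν : ℕ, M.P ν θ {ω | (⨅ u ∈ Metric.ball θ δ, M.Z ν (ν + (n + 1)) u ω) / ((n + 1 : ℕ) : EReal)
      < ((I θ - ε : ℝ) : EReal)}

/-- The left-tail condition `(A₂(r))`: the series above has a finite limit as `δ → 0`. -/
def ChangePointModel.LeftTail {Θ Ω 𝒳 : Type*} [MetricSpace Θ]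
    [MeasurableSpace Θ] [MeasurableSpace Ω] [MeasurableSpace 𝒳] (M : ChangePointModel Θ Ω 𝒳)
    (I : Θ → ℝ) (r : ℝ) : Prop :=
  ∀ (θ : Θ) (ε : ℝ), 0 < ε →
    ∃ L : ℝ≥0∞, L < ∞ ∧ Tendsto (fun δ : ℝ => M.leftTailSeries I r ε θ δ) (𝓝[>] 0) (𝓝 L)

/-- `b ~ c` along `l`: the ratio tends to one. In particular `b` is eventually finite when `c` is
eventually positive and finite. -/
def RatioEquiv {ι : Type*} (l : Filter ι) (b c : ι → ℝ≥0∞) : Prop :=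
  Tendsto (fun x => b x / c x) l (𝓝 1)

/-! Both bounds rest on changing measure between the no-change law and the post-change laws.

False alarms. Under no change the statistic has mean at most `n`: it is a `W`-average of `n`
likelihood ratios. Evaluating it on the events `T = k`, where it is at least `e^a`, and changing
measure term by term gives `P∞(T ≤ n) ≤ n e^{-a}` (`Pinf_T_le`). The geometric average of this bound
is `(1 - ϱ)/ϱ · e^{-a}`, which dictates the explicit threshold.

Lower bound (`le_risk_of_Pinf_le`). Fix `c < 1` and a window of `N ≈ c² s / I` observations after
the change. To stop in it, either the log-likelihood ratio reaches about `c s`, which `RightTail`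
makes unlikely, or the change of measure costs at most `e^{c s}` against a no-change probability of
order `e^{-(1+c)s/2}`. So the delay exceeds the window with probability at least `c`. For the class
`Δ(α)` take `s = |log α|`: the constraint gives `P∞(τ ≤ m) ≤ α/(1 - ϱ)^m`, and the denominator is
`e^{-o(s)}` for `m = O(s)`. For the procedure itself take `s = a`.

Upper bound (`risk_T_le`). Keeping only the true change point and a small ball around `θ`, the
statistic is at least `W(ball) · exp(inf Z)`. Once `n` exceeds about `a / I`, no alarm by `ν + n`
therefore forces the event in `LeftTail`, whose summability makes the excess delay contribute a
bounded amount to the moment, uniformly in `ν`. Conditioning on no false alarm costs a factor `1/(1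
- ν e^{-a})`, which stays near one also for all `ν ≤ k` when `k e^{-a} → 0`.

Letting `c → 1` in both bounds gives the equivalences. -/

namespace ChangePointModel

variable {Θ Ω 𝒳 : Type*} [MeasurableSpace Θ] [mΩ : MeasurableSpace Ω] [MeasurableSpace 𝒳]

/-! ### Likelihood ratios and change of measure -/

/-- The likelihood ratio of `n` observations for a change at `k` with parameter `θ`, as a function
of the vector of observations. -/
noncomputable def vecLR (M : ChangePointModel Θ Ω 𝒳) (k n : ℕ) (θ : Θ) (x : Fin n → 𝒳) : ℝ≥0∞ :=
  ∏ i : Fin n, if (i : ℕ) < k then 1 else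
    (M.f k θ i (initialSegment x i) (x i) : ℝ≥0∞) / (M.ψ i (initialSegment x i) (x i) : ℝ≥0∞)

/-- The likelihood ratio of the first `n` observations for a change at `k` with parameter `θ`. -/
noncomputable def LR (M : ChangePointModel Θ Ω 𝒳) (k n : ℕ) (θ : Θ) (ω : Ω) : ℝ≥0∞ :=
  ∏ i ∈ Finset.Ico k n, M.ratio k θ i ω

theorem LR_eq_vecLR (M : ChangePointModel Θ Ω 𝒳) (k n : ℕ) (θ : Θ) (ω : Ω) :
    M.LR k n θ ω = M.vecLR k n θ (M.hist n ω) := by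
  have h : M.vecLR k n θ (M.hist n ω)
      = ∏ i : Fin n, (fun i : ℕ => if i < k then 1 else M.ratio k θ i ω) i := rfl
  rw [h, ← Finset.prod_range (fun i : ℕ => if i < k then 1 else M.ratio k θ i ω), LR]
  have hs : Finset.Ico k n = (Finset.range n).filter (fun i => ¬ i < k) := by
    ext i; simp [and_comm]
  rw [hs, Finset.prod_filter]
  refine Finset.prod_congr rfl fun i _ => ?_
  by_cases hi : i < k <;> simp [hi]

theorem Z_eq_log_LR (M : ChangePointModel Θ Ω 𝒳) (k n : ℕ) (θ : Θ) (ω : Ω) :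
    M.Z k n θ ω = ENNReal.log (M.LR k n θ ω) := by
  unfold Z LR
  induction Finset.Ico k n using Finset.induction_on with
  | empty => simp
  | insert a s ha ih =>
    rw [Finset.sum_insert ha, Finset.prod_insert ha, ENNReal.log_mul_add, ih]

theorem measurable_initialSegment {n : ℕ} (i : Fin n) :
    Measurable (fun x : Fin n → 𝒳 => initialSegment x i) :=
  measurable_pi_lambda _ fun _ => measurable_pi_apply _

theorem measurable_ψ_vec (M : ChangePointModel Θ Ω 𝒳) {n : ℕ} (i : Fin n) :
    Measurable (fun x : Fin n → 𝒳 => (M.ψ i (initialSegment x i) (x i) : ℝ≥0∞)) :=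
  ((M.measurable_ψ i).comp
    ((measurable_initialSegment i).prodMk (measurable_pi_apply i))).coe_nnreal_ennreal

theorem measurable_f_vec (M : ChangePointModel Θ Ω 𝒳) (k : ℕ) {n : ℕ} (i : Fin n) :
    Measurable (fun p : Θ × (Fin n → 𝒳) =>
      (M.f k p.1 i (initialSegment p.2 i) (p.2 i) : ℝ≥0∞)) :=
  ((M.measurable_f k i).comp (measurable_fst.prodMk
    (((measurable_initialSegment i).comp measurable_snd).prodMk
      ((measurable_pi_apply i).comp measurable_snd)))).coe_nnreal_ennreal

theorem measurable_vecLR (M : ChangePointModel Θ Ω 𝒳) (k n : ℕ) :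
    Measurable (fun p : Θ × (Fin n → 𝒳) => M.vecLR k n p.1 p.2) := by
  refine Finset.measurable_prod _ fun i _ => ?_
  split_ifs
  · exact measurable_const
  · exact (M.measurable_f_vec k i).div ((M.measurable_ψ_vec i).comp measurable_snd)

theorem measurable_LR (M : ChangePointModel Θ Ω 𝒳) (k n : ℕ) :
    Measurable (fun p : Θ × Ω => M.LR k n p.1 p.2) := by
  simp only [LR_eq_vecLR]
  exact (M.measurable_vecLR k n).comp
    (measurable_fst.prodMk ((M.measurable_hist n).comp measurable_snd))

theorem measurable_preChangeJointDensity (M : ChangePointModel Θ Ω 𝒳) (n : ℕ) :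
    Measurable (preChangeJointDensity M.ψ n) :=
  Finset.measurable_prod _ fun i _ => M.measurable_ψ_vec i

/-- Only an inequality: where `ψ = 0 < f` the ratio is `∞`, and `0 * ∞ = 0` loses post-change mass.
-/
theorem pre_mul_vecLR_le_post (M : ChangePointModel Θ Ω 𝒳) (k n : ℕ) (θ : Θ) (x : Fin n → 𝒳) :
    preChangeJointDensity M.ψ n x * M.vecLR k n θ x
      ≤ postChangeJointDensity M.ψ (M.f k θ) k n x := by
  unfold preChangeJointDensity vecLR postChangeJointDensity
  rw [← Finset.prod_mul_distrib]
  refine Finset.prod_le_prod' fun i _ => ?_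
  split_ifs
  · simp
  · exact ENNReal.mul_div_le

/-- If the post-change density is positive and some `ψ` factor vanishes, that factor's ratio is
infinite while all others are nonzero, so the product is `∞`. Finiteness thus excludes the lossy
case. -/
theorem post_le_pre_mul_vecLR (M : ChangePointModel Θ Ω 𝒳) (k n : ℕ) (θ : Θ) (x : Fin n → 𝒳)
    (h : M.vecLR k n θ x ≠ ∞) :
    postChangeJointDensity M.ψ (M.f k θ) k n x
      ≤ preChangeJointDensity M.ψ n x * M.vecLR k n θ x := by
  by_cases h0 : postChangeJointDensity M.ψ (M.f k θ) k n x = 0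
  · rw [h0]; exact zero_le
  have hne := Finset.prod_ne_zero_iff.1 h0
  have hψ : ∀ i : Fin n, M.ψ i (initialSegment x i) (x i) ≠ 0 := by
    intro i hi
    have h1 := hne i (Finset.mem_univ i)
    by_cases hik : (i : ℕ) < k
    · simp [hik, hi] at h1
    apply h
    unfold vecLR
    rw [← Finset.mul_prod_erase _ _ (Finset.mem_univ i)]
    have h2 : M.f k θ i (initialSegment x i) (x i) ≠ 0 := by simpa [hik] using h1
    rw [if_neg hik, hi, ENNReal.coe_zero, ENNReal.div_zero (by simpa using h2)]
    refine ENNReal.top_mul (Finset.prod_ne_zero_iff.2 fun j _ => ?_)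
    have h3 := hne j (Finset.mem_univ j)
    split_ifs with hj
    · exact one_ne_zero
    · simp only [hj, if_false] at h3
      exact (ENNReal.div_pos h3 ENNReal.coe_ne_top).ne'
  unfold preChangeJointDensity vecLR postChangeJointDensity
  rw [← Finset.prod_mul_distrib]
  refine Finset.prod_le_prod' fun i _ => ?_
  split_ifs
  · simp
  · rw [ENNReal.mul_div_cancel (by simpa using hψ i) ENNReal.coe_ne_top]

/-- Change of measure from the pre-change law to a post-change one. -/
theorem setLIntegral_LR_le (M : ChangePointModel Θ Ω 𝒳) (k n : ℕ) (θ : Θ) {A : Set Ω}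
    (hA : MeasurableSet[M.obsFiltration n] A) :
    ∫⁻ ω in A, M.LR k n θ ω ∂M.Pinf ≤ M.P k θ A := by
  obtain ⟨B, hB, rfl⟩ := hA
  have hm : Measurable (M.vecLR k n θ) := (M.measurable_vecLR k n).comp measurable_prodMk_left
  have h1 := setLIntegral_map (μ := M.Pinf) hB hm (M.measurable_hist n)
  simp only [LR_eq_vecLR]
  rw [← h1, ← Measure.map_apply (M.measurable_hist n) hB]
  change ∫⁻ y in B, M.vecLR k n θ y ∂M.Pinf.map (fun ω (i : Fin n) => M.X i ω)
    ≤ (M.P k θ).map (fun ω (i : Fin n) => M.X i ω) B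
  rw [M.law_Pinf n, M.law_P k θ n, withDensity_apply _ hB,
    setLIntegral_withDensity_eq_setLIntegral_mul _ (M.measurable_preChangeJointDensity n) hm hB]
  exact lintegral_mono fun x => M.pre_mul_vecLR_le_post k n θ x

/-- Change of measure from a post-change law to the pre-change one, where the likelihood ratio is
bounded. -/
theorem P_le_mul_Pinf (M : ChangePointModel Θ Ω 𝒳) (k n : ℕ) (θ : Θ) {A : Set Ω}
    (hA : MeasurableSet[M.obsFiltration n] A) {c : ℝ≥0∞} (hc : c ≠ ∞)
    (hAc : ∀ ω ∈ A, M.LR k n θ ω ≤ c) :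
    M.P k θ A ≤ c * M.Pinf A := by
  obtain ⟨B, hB, rfl⟩ := hA
  have hm : Measurable (M.vecLR k n θ) := (M.measurable_vecLR k n).comp measurable_prodMk_left
  have hB' : MeasurableSet (B ∩ {x | M.vecLR k n θ x ≤ c}) :=
    hB.inter (measurableSet_le hm measurable_const)
  have heq : M.hist n ⁻¹' B = M.hist n ⁻¹' (B ∩ {x | M.vecLR k n θ x ≤ c}) := by
    ext ω
    refine ⟨fun h => ⟨h, ?_⟩, fun h => h.1⟩
    have := hAc ω h
    rwa [LR_eq_vecLR] at this
  rw [heq, ← Measure.map_apply (M.measurable_hist n) hB',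
    ← Measure.map_apply (M.measurable_hist n) hB']
  change (M.P k θ).map (fun ω (i : Fin n) => M.X i ω) _
    ≤ c * M.Pinf.map (fun ω (i : Fin n) => M.X i ω) _
  rw [M.law_Pinf n, M.law_P k θ n, withDensity_apply _ hB', withDensity_apply _ hB',
    ← lintegral_const_mul _ (M.measurable_preChangeJointDensity n)]
  refine setLIntegral_mono' hB' fun x hx => ?_
  refine (M.post_le_pre_mul_vecLR k n θ x (ne_top_of_le_ne_top hc hx.2)).trans ?_
  rw [mul_comm]
  exact mul_le_mul_left hx.2 _

/-- Before the change the post-change law agrees with the pre-change one. -/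
theorem P_eq_Pinf (M : ChangePointModel Θ Ω 𝒳) (k : ℕ) (θ : Θ) {A : Set Ω}
    (hA : MeasurableSet[M.obsFiltration k] A) : M.P k θ A = M.Pinf A := by
  obtain ⟨B, hB, rfl⟩ := hA
  rw [← Measure.map_apply (M.measurable_hist k) hB, ← Measure.map_apply (M.measurable_hist k) hB]
  change (M.P k θ).map (fun ω (i : Fin k) => M.X i ω) _
    = M.Pinf.map (fun ω (i : Fin k) => M.X i ω) _
  rw [M.law_Pinf k, M.law_P k θ k]
  congr 2
  funext x
  simp [preChangeJointDensity, postChangeJointDensity]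

/-! ### Measurability and the stopping rule -/

theorem measurable_SR (M : ChangePointModel Θ Ω 𝒳) (n : ℕ) :
    Measurable (fun p : Θ × Ω => M.SR n p.1 p.2) :=
  Finset.measurable_sum _ fun k _ => M.measurable_LR k n

theorem measurable_WSR (M : ChangePointModel Θ Ω 𝒳) (W : Measure Θ) [IsProbabilityMeasure W]
    (n : ℕ) : Measurable[M.obsFiltration n] (M.WSR W n) := by
  let g : (Fin n → 𝒳) → ℝ≥0∞ := fun x => ∫⁻ θ, ∑ k ∈ Finset.range n, M.vecLR k n θ x ∂W
  have hg : Measurable g := by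
    refine Measurable.lintegral_prod_left'
      (f := fun p : Θ × (Fin n → 𝒳) => ∑ k ∈ Finset.range n, M.vecLR k n p.1 p.2) ?_
    exact Finset.measurable_sum _ fun k _ => M.measurable_vecLR k n
  have h : M.WSR W n = g ∘ M.hist n := by
    funext ω
    simp only [WSR, SR, g, Function.comp, ← LR_eq_vecLR]
    rfl
  rw [h]
  exact hg.comp (comap_measurable _)

/-- `ℕ∞` is well-ordered, so a nonempty set of alarm times contains its infimum; an empty one gives
`⊤`, which is not below `n`. -/
theorem T_le_iff (M : ChangePointModel Θ Ω 𝒳) (W : Measure Θ) (a : ℝ) (ω : Ω) (n : ℕ) :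
    M.T W a ω ≤ n ↔ ∃ m : ℕ, m ≤ n ∧ 1 ≤ m ∧ (a : EReal) ≤ ENNReal.log (M.WSR W m ω) := by
  constructor
  · intro h
    by_cases hne : {t : ℕ∞ | ∃ n : ℕ, t = n ∧ 1 ≤ n ∧
        (a : EReal) ≤ ENNReal.log (M.WSR W n ω)}.Nonempty
    · obtain ⟨m, hm, h1, h2⟩ := csInf_mem hne
      refine ⟨m, ?_, h1, h2⟩
      unfold T at h
      rw [hm] at h
      exact_mod_cast h
    · unfold T at h
      rw [Set.not_nonempty_iff_eq_empty.1 hne, sInf_empty] at h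
      simp at h
  · rintro ⟨m, hmn, h1, h2⟩
    refine le_trans (b := (m : ℕ∞)) (sInf_le ?_) (by exact_mod_cast hmn)
    exact ⟨m, rfl, h1, h2⟩

theorem le_log_WSR_of_T_eq (M : ChangePointModel Θ Ω 𝒳) (W : Measure Θ) (a : ℝ) (ω : Ω) (n : ℕ)
    (h : M.T W a ω = n) : 1 ≤ n ∧ (a : EReal) ≤ ENNReal.log (M.WSR W n ω) := by
  obtain ⟨m, hm, h1, h2⟩ := (M.T_le_iff W a ω n).1 h.le
  have h3 : M.T W a ω ≤ m := (M.T_le_iff W a ω m).2 ⟨m, le_rfl, h1, h2⟩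
  rw [h] at h3
  have h4 : n = m := le_antisymm (by exact_mod_cast h3) hm
  exact h4 ▸ ⟨h1, h2⟩

theorem isStoppingTime_T (M : ChangePointModel Θ Ω 𝒳) (W : Measure Θ) [IsProbabilityMeasure W]
    (a : ℝ) : IsStoppingTime M.obsFiltration (M.T W a) := by
  intro n
  have h : {ω | M.T W a ω ≤ (n : ℕ∞)} =
      ⋃ m ∈ Finset.Icc 1 n, {ω | (a : EReal) ≤ ENNReal.log (M.WSR W m ω)} := by
    ext ω
    simp only [Set.mem_ofPred_eq, T_le_iff, Set.mem_iUnion, Finset.mem_Icc, exists_prop]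
    exact ⟨fun ⟨m, h1, h2, h3⟩ => ⟨m, ⟨h2, h1⟩, h3⟩, fun ⟨m, ⟨h2, h1⟩, h3⟩ => ⟨m, h1, h2, h3⟩⟩
  change MeasurableSet[M.obsFiltration n] {ω | M.T W a ω ≤ (n : ℕ∞)}
  rw [h]
  refine Finset.measurableSet_biUnion _ fun m hm => ?_
  refine M.obsFiltration.mono (Finset.mem_Icc.1 hm).2 _ ?_
  exact @measurableSet_le _ _ _ _ _ (M.obsFiltration m) _ _ _ _ _ measurable_const
    (ENNReal.measurable_log.comp (M.measurable_WSR W m))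

end ChangePointModel

/-! ### False alarm probabilities -/

namespace ChangePointModel

variable {Θ Ω 𝒳 : Type*} [MeasurableSpace Θ] [mΩ : MeasurableSpace Ω] [MeasurableSpace 𝒳]

theorem _root_.MeasureTheory.sum_measure_fiber_natCast {α : Type*} {m : MeasurableSpace α}
    (μ : Measure α) (τ : α → ℕ∞) (hτ : ∀ n : ℕ, MeasurableSet {x | τ x = n}) (s : Finset ℕ) :
    ∑ n ∈ s, μ {x | τ x = n} = μ {x | ∃ n ∈ s, τ x = n} := by
  rw [← measure_biUnion_finset _ fun n _ => hτ n]
  · congr 1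
    ext x
    simp
  · intro i _ j _ hij
    refine Set.disjoint_left.2 fun x hx hy => hij ?_
    have h : (i : ℕ∞) = j := hx.symm.trans hy
    exact_mod_cast h

/-- The local false alarm probability of the weighted Shiryaev–Roberts procedure. -/
theorem Pinf_T_le (M : ChangePointModel Θ Ω 𝒳) (W : Measure Θ) [IsProbabilityMeasure W]
    (a : ℝ) (n : ℕ) :
    M.Pinf {ω | M.T W a ω ≤ (n : ℕ∞)} ≤ ENNReal.ofReal (n * Real.exp (-a)) := by
  have hPi := M.isProbabilityMeasure_Pinf
  have hτ := M.isStoppingTime_T W a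
  have hmeas : ∀ k : ℕ, MeasurableSet[M.obsFiltration k] {ω | M.T W a ω = (k : ℕ∞)} :=
    fun k => hτ.measurableSet_eq k
  have hmeas' : ∀ k : ℕ, MeasurableSet {ω | M.T W a ω = (k : ℕ∞)} :=
    fun k => M.obsFiltration.le k _ (hmeas k)
  set g : ℕ → ℕ → Θ → ℝ≥0∞ := fun k j θ =>
    ∫⁻ ω in {ω | M.T W a ω = (k : ℕ∞)}, M.LR j k θ ω ∂M.Pinf with hg
  have hgm : ∀ k j, Measurable (g k j) := fun k j =>
    Measurable.lintegral_prod_right' (M.measurable_LR j k)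
  -- On `T = k` the statistic is at least `e^a`; Tonelli moves the mixture over `θ` outside.
  have hone : ∀ k : ℕ, ENNReal.ofReal (Real.exp a) * M.Pinf {ω | M.T W a ω = (k : ℕ∞)}
      ≤ ∫⁻ θ, ∑ j ∈ Finset.range k, g k j θ ∂W := by
    intro k
    have h1 : ∫⁻ θ, ∑ j ∈ Finset.range k, g k j θ ∂W
        = ∫⁻ ω in {ω | M.T W a ω = (k : ℕ∞)}, M.WSR W k ω ∂M.Pinf := by
      unfold WSR
      rw [lintegral_lintegral_swap (f := fun ω θ => M.SR k θ ω)
        ((M.measurable_SR k).comp measurable_swap).aemeasurable]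
      refine lintegral_congr fun θ => ?_
      unfold SR
      rw [lintegral_finsetSum]
      · rfl
      · exact fun j _ => (M.measurable_LR j k).comp measurable_prodMk_left
    rw [h1, ← setLIntegral_const]
    refine setLIntegral_mono' (hmeas' k) fun ω hω => ?_
    have h2 := EReal.exp_le_exp_iff.2 (M.le_log_WSR_of_T_eq W a ω k hω).2
    rwa [EReal.exp_coe, ENNReal.exp_log] at h2
  have hset : {ω | M.T W a ω ≤ (n : ℕ∞)} = {ω | ∃ k ∈ Finset.Icc 1 n, M.T W a ω = (k : ℕ∞)} := by
    ext ω
    simp only [Set.mem_ofPred_eq, Finset.mem_Icc]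
    constructor
    · intro h
      obtain ⟨k, hk⟩ := ENat.ne_top_iff_exists.1 (ne_top_of_le_ne_top (ENat.natCast_ne_top n) h)
      refine ⟨k, ⟨(M.le_log_WSR_of_T_eq W a ω k hk.symm).1, ?_⟩, hk.symm⟩
      rw [← hk] at h
      exact_mod_cast h
    · rintro ⟨k, ⟨-, hk⟩, h⟩
      rw [h]
      exact_mod_cast hk
  -- For each change point `j < n` the events `T = k` are disjoint in `k`, so their probabilities
  -- under `P j θ` sum to at most one; there are `n` such `j`.
  have hmain : ENNReal.ofReal (Real.exp a) * M.Pinf {ω | M.T W a ω ≤ (n : ℕ∞)} ≤ n := by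
    rw [hset, ← sum_measure_fiber_natCast _ _ hmeas', Finset.mul_sum]
    refine (Finset.sum_le_sum fun k _ => hone k).trans ?_
    rw [← lintegral_finsetSum _ fun k _ => Finset.measurable_sum _ fun j _ => hgm k j]
    calc ∫⁻ θ, ∑ k ∈ Finset.Icc 1 n, ∑ j ∈ Finset.range k, g k j θ ∂W
        ≤ ∫⁻ _, (n : ℝ≥0∞) ∂W := lintegral_mono fun θ => ?_
      _ = n := by simp
    calc ∑ k ∈ Finset.Icc 1 n, ∑ j ∈ Finset.range k, g k j θ
        ≤ ∑ k ∈ Finset.Icc 1 n, ∑ j ∈ Finset.range n, M.P j θ {ω | M.T W a ω = (k : ℕ∞)} := by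
          refine Finset.sum_le_sum fun k hk => ?_
          refine (Finset.sum_le_sum fun j _ => M.setLIntegral_LR_le j k θ (hmeas k)).trans ?_
          exact Finset.sum_le_sum_of_subset
            (Finset.range_subset_range.2 (Finset.mem_Icc.1 hk).2)
      _ = ∑ j ∈ Finset.range n, ∑ k ∈ Finset.Icc 1 n, M.P j θ {ω | M.T W a ω = (k : ℕ∞)} :=
          Finset.sum_comm
      _ ≤ ∑ j ∈ Finset.range n, (1 : ℝ≥0∞) := by
          refine Finset.sum_le_sum fun j _ => ?_
          have := M.isProbabilityMeasure_P j θ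
          rw [sum_measure_fiber_natCast _ _ hmeas']
          exact prob_le_one
      _ = n := by simp
  have he : ENNReal.ofReal (Real.exp (-a)) * ENNReal.ofReal (Real.exp a) = 1 := by
    rw [← ENNReal.ofReal_mul (Real.exp_pos _).le, ← Real.exp_add]
    simp
  calc M.Pinf {ω | M.T W a ω ≤ (n : ℕ∞)}
      = ENNReal.ofReal (Real.exp (-a)) *
        (ENNReal.ofReal (Real.exp a) * M.Pinf {ω | M.T W a ω ≤ (n : ℕ∞)}) := by
        rw [← mul_assoc, he, one_mul]
    _ ≤ ENNReal.ofReal (Real.exp (-a)) * n := by gcongr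
    _ = ENNReal.ofReal (n * Real.exp (-a)) := by
        rw [ENNReal.ofReal_mul (Nat.cast_nonneg n), ENNReal.ofReal_natCast, mul_comm]

/-- The geometric prior has mean `(1 - p)/p`, and the local bound `k e^{-a}` is linear in `k`. -/
theorem PFA_T_le (M : ChangePointModel Θ Ω 𝒳) (W : Measure Θ) [IsProbabilityMeasure W]
    (a : ℝ) {p : ℝ} (hp : p ∈ Set.Ioo (0 : ℝ) 1) :
    M.PFA p (M.T W a) ≤ ENNReal.ofReal ((1 - p) / p * Real.exp (-a)) := by
  have hp0 : 0 < p := hp.1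
  have hp1 : 0 < 1 - p := by linarith [hp.2]
  have hsum := (hasSum_coe_mul_geometric_of_norm_lt_one (𝕜 := ℝ) (r := 1 - p)
    (by rw [Real.norm_eq_abs, abs_of_pos hp1]; linarith)).mul_left (p * Real.exp (-a))
  have hval : p * Real.exp (-a) * ((1 - p) / (1 - (1 - p)) ^ 2)
      = (1 - p) / p * Real.exp (-a) := by
    rw [sub_sub_cancel]
    field_simp
  rw [hval] at hsum
  rw [← hsum.tsum_eq, ENNReal.ofReal_tsum_of_nonneg (fun k => by positivity) hsum.summable]
  refine ENNReal.tsum_le_tsum fun k => ?_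
  refine (mul_le_mul_right (M.Pinf_T_le W a k) _).trans ?_
  rw [← ENNReal.ofReal_mul (by positivity)]
  exact ENNReal.ofReal_le_ofReal (le_of_eq (by ring))

/-- The probability of stopping by the time `m` is controlled by the weighted probability of
false alarm. -/
theorem Pinf_le_of_PFA_le (M : ChangePointModel Θ Ω 𝒳) {α p : ℝ} (hp : p ∈ Set.Ioo (0 : ℝ) 1)
    {τ : Ω → ℕ∞} (h : M.PFA p τ ≤ ENNReal.ofReal α) (m : ℕ) :
    M.Pinf {ω | τ ω ≤ (m : ℕ∞)} ≤ ENNReal.ofReal (α / (1 - p) ^ m) := by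
  have hp0 : 0 < p := hp.1
  have hp1 : 0 < 1 - p := by linarith [hp.2]
  -- The prior mass of `k ≥ m` is `(1 - p)^m`, and for those `k` the event `τ ≤ k` contains `τ ≤ m`.
  have hgeo : HasSum (fun k : ℕ => p * (1 - p) ^ (k + m)) ((1 - p) ^ m) := by
    have h1 := (hasSum_geometric_of_lt_one hp1.le (by linarith : 1 - p < 1)).mul_left
      (p * (1 - p) ^ m)
    have h2 : p * (1 - p) ^ m * (1 - (1 - p))⁻¹ = (1 - p) ^ m := by
      rw [sub_sub_cancel]
      field_simp
    have h3 : (fun k : ℕ => p * (1 - p) ^ (k + m)) = fun k => p * (1 - p) ^ m * (1 - p) ^ k := by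
      funext k
      ring
    rw [h2] at h1
    rwa [h3]
  have h1 : ENNReal.ofReal ((1 - p) ^ m) * M.Pinf {ω | τ ω ≤ (m : ℕ∞)} ≤ ENNReal.ofReal α := by
    refine le_trans ?_ h
    rw [← hgeo.tsum_eq, ENNReal.ofReal_tsum_of_nonneg (fun k => by positivity) hgeo.summable,
      ← ENNReal.tsum_mul_right]
    refine le_trans (ENNReal.tsum_le_tsum (g := fun k : ℕ => ENNReal.ofReal (p * (1 - p) ^ (k + m))
      * M.Pinf {ω | τ ω ≤ ((k + m : ℕ) : ℕ∞)}) fun k => ?_) ?_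
    · refine mul_le_mul_right (measure_mono fun ω (hω : τ ω ≤ m) => ?_) _
      refine hω.trans ?_
      exact_mod_cast Nat.le_add_left m k
    · exact ENNReal.tsum_comp_le_tsum_of_injective (f := fun k : ℕ => k + m)
        (fun a b hab => by simpa using hab)
        (fun k : ℕ => ENNReal.ofReal (p * (1 - p) ^ k) * M.Pinf {ω | τ ω ≤ (k : ℕ∞)})
  rw [ENNReal.ofReal_div_of_pos (by positivity), ENNReal.le_div_iff_mul_le, mul_comm]
  · exact h1
  · left; simpa using pow_pos hp1 m
  · left; exact ENNReal.ofReal_ne_top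

theorem T_mem_Delta (M : ChangePointModel Θ Ω 𝒳) (W : Measure Θ) [IsProbabilityMeasure W]
    {α p : ℝ} (hα : 0 < α) (hp : p ∈ Set.Ioo (0 : ℝ) 1) :
    M.T W (Real.log ((1 - p) / (p * α))) ∈ M.Delta α p := by
  have hp0 : 0 < p := hp.1
  have hp1 : 0 < 1 - p := by linarith [hp.2]
  refine ⟨M.isStoppingTime_T W _, (M.PFA_T_le W _ hp).trans (ENNReal.ofReal_le_ofReal ?_)⟩
  rw [Real.exp_neg, Real.exp_log (by positivity)]
  field_simp
  exact le_rfl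

end ChangePointModel

/-! ### Asymptotic equivalence from two-sided bounds -/

theorem RatioEquiv.inv {ι : Type*} {l : Filter ι} {b c : ι → ℝ≥0∞} (h : RatioEquiv l b c)
    (hc : ∀ᶠ x in l, c x ≠ 0 ∧ c x ≠ ∞) : RatioEquiv l c b := by
  have h1 : Tendsto (fun x => (b x / c x)⁻¹) l (𝓝 1) := by
    simpa using tendsto_inv_iff.2 h
  refine h1.congr' (hc.mono fun x hx => ?_)
  exact ENNReal.inv_div (Or.inl hx.2) (Or.inl hx.1)

theorem tendsto_cube_mul_cube_rpow (q : ℝ) :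
    Tendsto (fun c : ℝ => c ^ 3 * (c ^ 3) ^ q) (𝓝 1) (𝓝 1) := by
  have h : ContinuousAt (fun c : ℝ => c ^ 3 * (c ^ 3) ^ q) 1 :=
    (continuousAt_id.pow 3).mul
      ((continuousAt_id.pow 3).rpow_const (Or.inl (by norm_num)))
  simpa [ContinuousAt] using h

/-- The slack `c ^ 3 * (c ^ 3) ^ q` tends to one as `c → 1`. Cubes give one common shape with room
for every loss in the lower and upper risk bounds. -/
theorem RatioEquiv.of_bounds {ι : Type*} {l : Filter ι} {b : ι → ℝ≥0∞} {y : ι → ℝ} {q : ℝ}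
    (hy : ∀ᶠ x in l, 0 < y x)
    (hlow : ∀ c ∈ Set.Ioo (0 : ℝ) 1,
      ∀ᶠ x in l, ENNReal.ofReal (c ^ 3 * (c ^ 3 * y x) ^ q) ≤ b x)
    (hup : ∀ c : ℝ, 1 < c → ∀ᶠ x in l, b x ≤ ENNReal.ofReal (c ^ 3 * (c ^ 3 * y x) ^ q)) :
    RatioEquiv l b (fun x => ENNReal.ofReal (y x ^ q)) := by
  have hcont : Tendsto (fun c : ℝ => ENNReal.ofReal (c ^ 3 * (c ^ 3) ^ q)) (𝓝 1) (𝓝 1) := by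
    simpa using ENNReal.tendsto_ofReal (tendsto_cube_mul_cube_rpow q)
  have hsplit : ∀ c : ℝ, 0 < c → ∀ x, 0 < y x →
      ENNReal.ofReal (c ^ 3 * (c ^ 3 * y x) ^ q)
        = ENNReal.ofReal (c ^ 3 * (c ^ 3) ^ q) * ENNReal.ofReal (y x ^ q) := by
    intro c hc x hx
    rw [← ENNReal.ofReal_mul (by positivity), Real.mul_rpow (by positivity) hx.le, mul_assoc]
  have hpos : ∀ x, 0 < y x → ENNReal.ofReal (y x ^ q) ≠ 0 := fun x hx => by
    simpa using Real.rpow_pos_of_pos hx q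
  refine tendsto_order.2 ⟨fun d hd => ?_, fun d hd => ?_⟩
  · have h1 := (hcont.mono_left nhdsWithin_le_nhds : Tendsto _ (𝓝[<] (1 : ℝ)) _)
    obtain ⟨c, hc1, hc2⟩ := ((h1.eventually (lt_mem_nhds hd)).and
      (Ioo_mem_nhdsLT (zero_lt_one (α := ℝ)))).exists
    filter_upwards [hlow c hc2, hy] with x hx hyx
    refine hc1.trans_le ?_
    rw [ENNReal.le_div_iff_mul_le (Or.inl (hpos x hyx)) (Or.inl ENNReal.ofReal_ne_top),
      ← hsplit c hc2.1 x hyx]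
    exact hx
  · have h1 := (hcont.mono_left nhdsWithin_le_nhds : Tendsto _ (𝓝[>] (1 : ℝ)) _)
    obtain ⟨c, hc1, hc2⟩ := ((h1.eventually (gt_mem_nhds hd)).and
      (self_mem_nhdsWithin (s := Set.Ioi (1 : ℝ)))).exists
    have hc2' : (1 : ℝ) < c := hc2
    filter_upwards [hup c hc2', hy] with x hx hyx
    refine lt_of_le_of_lt ?_ hc1
    rw [ENNReal.div_le_iff (hpos x hyx) ENNReal.ofReal_ne_top,
      ← hsplit c (by linarith) x hyx]
    exact hx

/-! ### Lower bound for the risk -/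

namespace ChangePointModel

variable {Θ Ω 𝒳 : Type*} [MeasurableSpace Θ] [mΩ : MeasurableSpace Ω] [MeasurableSpace 𝒳]

theorem setLIntegral_le_risk (M : ChangePointModel Θ Ω 𝒳) (q : ℝ) (ν : ℕ) (θ : Θ)
    (τ : Ω → ℕ∞) :
    ∫⁻ ω in {ω | (ν : ℕ∞) < τ ω}, ((τ ω : ℝ≥0∞) - (ν : ℝ≥0∞)) ^ q ∂M.P ν θ
      ≤ M.risk q ν θ τ := by
  have := M.isProbabilityMeasure_P ν θ
  unfold risk ProbabilityTheory.cond
  rw [lintegral_smul_measure, smul_eq_mul]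
  exact le_mul_of_one_le_left zero_le (ENNReal.one_le_inv.2 prob_le_one)

/-- The probability to stop within `N` observations after the change. -/
theorem P_stop_window_le (M : ChangePointModel Θ Ω 𝒳) {τ : Ω → ℕ∞}
    (hτ : IsStoppingTime M.obsFiltration τ) (ν : ℕ) (θ : Θ) (N : ℕ) (C : ℝ) :
    M.P ν θ {ω | (ν : ℕ∞) < τ ω ∧ τ ω ≤ ((ν + N : ℕ) : ℕ∞)} ≤
      M.P ν θ {ω | ∃ n ∈ Finset.Icc 1 N, (C : EReal) ≤ M.Z ν (ν + n) θ ω} +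
        ENNReal.ofReal (Real.exp C) * M.Pinf {ω | τ ω ≤ ((ν + N : ℕ) : ℕ∞)} := by
  have hmeas : ∀ n : ℕ, MeasurableSet[M.obsFiltration n] {ω | τ ω = (n : ℕ∞)} :=
    fun n => hτ.measurableSet_eq n
  -- Split according to whether `Z` reaches `C` at the stopping time. On `A n` it does not, so the
  -- change of measure costs at most `e^C`.
  set A : ℕ → Set Ω := fun n =>
    {ω | τ ω = (n : ℕ∞)} ∩ {ω | M.LR ν n θ ω ≤ ENNReal.ofReal (Real.exp C)} with hA
  have hAm : ∀ n, MeasurableSet[M.obsFiltration n] (A n) := by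
    intro n
    refine (hmeas n).inter ?_
    refine ⟨{x | M.vecLR ν n θ x ≤ ENNReal.ofReal (Real.exp C)}, ?_, ?_⟩
    · exact measurableSet_le ((M.measurable_vecLR ν n).comp measurable_prodMk_left)
        measurable_const
    · ext ω
      simp [LR_eq_vecLR]
  have hsub : {ω | (ν : ℕ∞) < τ ω ∧ τ ω ≤ ((ν + N : ℕ) : ℕ∞)} ⊆
      {ω | ∃ n ∈ Finset.Icc 1 N, (C : EReal) ≤ M.Z ν (ν + n) θ ω} ∪
        ⋃ n ∈ Finset.Ioc ν (ν + N), A n := by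
    rintro ω ⟨h1, h2⟩
    obtain ⟨n, hn⟩ := ENat.ne_top_iff_exists.1 (ne_top_of_le_ne_top (ENat.natCast_ne_top _) h2)
    rw [← hn] at h1 h2
    have h1' : ν < n := by exact_mod_cast h1
    have h2' : n ≤ ν + N := by exact_mod_cast h2
    by_cases hC : (C : EReal) ≤ M.Z ν n θ ω
    · refine Or.inl ⟨n - ν, Finset.mem_Icc.2 ⟨by omega, by omega⟩, ?_⟩
      rwa [Nat.add_sub_cancel' h1'.le]
    · refine Or.inr (Set.mem_biUnion (Finset.mem_coe.2 (Finset.mem_Ioc.2 ⟨h1', h2'⟩))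
        ⟨hn.symm, ?_⟩)
      have h3 := EReal.exp_le_exp_iff.2 (not_le.1 hC).le
      rwa [Z_eq_log_LR, ENNReal.exp_log, EReal.exp_coe] at h3
  refine (measure_mono hsub).trans ((measure_union_le _ _).trans (add_le_add le_rfl ?_))
  refine (measure_biUnion_finset_le _ _).trans ?_
  calc ∑ n ∈ Finset.Ioc ν (ν + N), M.P ν θ (A n)
      ≤ ∑ n ∈ Finset.Ioc ν (ν + N),
          ENNReal.ofReal (Real.exp C) * M.Pinf {ω | τ ω = (n : ℕ∞)} := by
        refine Finset.sum_le_sum fun n _ => ?_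
        refine (M.P_le_mul_Pinf ν n θ (hAm n) ENNReal.ofReal_ne_top fun ω hω => hω.2).trans ?_
        exact mul_le_mul_right (measure_mono Set.inter_subset_left) _
    _ ≤ ENNReal.ofReal (Real.exp C) * M.Pinf {ω | τ ω ≤ ((ν + N : ℕ) : ℕ∞)} := by
        rw [← Finset.mul_sum, sum_measure_fiber_natCast _ _
          (fun n => M.obsFiltration.le n _ (hmeas n))]
        refine mul_le_mul_right (measure_mono ?_) _
        rintro ω ⟨n, hn, h⟩
        change τ ω ≤ _
        rw [h]
        exact_mod_cast (Finset.mem_Ioc.1 hn).2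

/-- A detection delay lower bound, uniform over the stopping times with a small local false alarm
probability. -/
theorem le_risk_of_Pinf_le (M : ChangePointModel Θ Ω 𝒳) {I : Θ → ℝ} (hA1 : M.RightTail I)
    {θ : Θ} (hI : 0 < I θ) {q : ℝ} (hq : 0 ≤ q) (ν : ℕ) {c : ℝ} (hc : c ∈ Set.Ioo (0 : ℝ) 1) :
    ∀ᶠ s : ℝ in atTop, ∀ τ : Ω → ℕ∞, IsStoppingTime M.obsFiltration τ →
      M.Pinf {ω | τ ω ≤ ((ν + ⌊c ^ 2 * s / I θ⌋₊ : ℕ) : ℕ∞)}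
        ≤ ENNReal.ofReal (Real.exp (-((1 + c) / 2 * s))) →
      ENNReal.ofReal (c ^ 3 * (c ^ 3 * (s / I θ)) ^ q) ≤ M.risk q ν θ τ := by
  obtain ⟨hc0, hc1⟩ := hc
  -- With this `ε`, the level `(1 + ε) I N = (I / c) N` is at most `c s` for `N ≤ c² s / I`.
  have hε : 0 < 1 / c - 1 := by
    rw [sub_pos, lt_div_iff₀ hc0]; linarith
  have hN : Tendsto (fun s : ℝ => ⌊c ^ 2 * s / I θ⌋₊) atTop atTop := by
    refine tendsto_nat_floor_atTop.comp ?_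
    exact (tendsto_id.const_mul_atTop (by positivity : 0 < c ^ 2)).atTop_div_const hI
  have hlim1 := (hA1 θ ν (1 / c - 1) hε).comp hN
  have hexp : ∀ k : ℝ, 0 < k →
      Tendsto (fun s : ℝ => ENNReal.ofReal (Real.exp (-(k * s)))) atTop (𝓝 0) := by
    intro k hk
    have h1 : Tendsto (fun s : ℝ => Real.exp (-(k * s))) atTop (𝓝 0) :=
      Real.tendsto_exp_neg_atTop_nhds_zero.comp (tendsto_id.const_mul_atTop hk)
    simpa using ENNReal.tendsto_ofReal h1
  -- Three errors: stopping before the change, a large likelihood ratio in the window, and the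
  -- change-of-measure term `e^{cs} e^{-(1+c)s/2}`.
  have hlim := ((hexp ((1 + c) / 2) (by linarith)).add
    (hlim1.add (hexp ((1 - c) / 2) (by linarith))))
  simp only [add_zero] at hlim
  have hev := hlim.eventually (gt_mem_nhds (ENNReal.ofReal_pos.2 (sub_pos.2 hc1)))
  filter_upwards [hev, hN.eventually_ge_atTop 1, eventually_gt_atTop 0] with s hs hN1 hs0 τ hτ hfa
  have := M.isProbabilityMeasure_P ν θ
  have hle : ∀ n : ℕ, MeasurableSet[M.obsFiltration n] {ω | τ ω ≤ (n : ℕ∞)} := fun n => hτ n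
  set N := ⌊c ^ 2 * s / I θ⌋₊ with hNdef
  have hNle : (N : ℝ) ≤ c ^ 2 * s / I θ := Nat.floor_le (by positivity)
  set C : ℝ := (1 + (1 / c - 1)) * I θ * N with hCdef
  have hC : C ≤ c * s := by
    have h1 : C = I θ / c * N := by rw [hCdef]; ring
    rw [h1]
    calc I θ / c * N ≤ I θ / c * (c ^ 2 * s / I θ) := by gcongr
      _ = c * s := by field_simp
  have hwin := M.P_stop_window_le hτ ν θ N C
  have hA : M.P ν θ {ω | ∃ n ∈ Finset.Icc 1 N, (C : EReal) ≤ M.Z ν (ν + n) θ ω} ≤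
      M.P ν θ {ω | (((1 + (1 / c - 1)) * I θ : ℝ) : EReal) ≤
        (⨆ n ∈ Finset.Icc 1 N, M.Z ν (ν + n) θ ω) / (N : EReal)} := by
    refine measure_mono ?_
    rintro ω ⟨n, hn, h⟩
    rw [Set.mem_ofPred_eq, EReal.le_div_iff_mul_le (by exact_mod_cast hN1) (EReal.natCast_ne_top N)]
    refine le_trans (le_of_eq ?_) (h.trans
      (le_iSup₂ (f := fun n (_ : n ∈ Finset.Icc 1 N) => M.Z ν (ν + n) θ ω) n hn))
    rw [hCdef, EReal.coe_mul _ (N : ℝ)]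
    rfl
  have hB : ENNReal.ofReal (Real.exp C) * M.Pinf {ω | τ ω ≤ ((ν + N : ℕ) : ℕ∞)}
      ≤ ENNReal.ofReal (Real.exp (-((1 - c) / 2 * s))) := by
    refine (mul_le_mul_right hfa _).trans ?_
    rw [← ENNReal.ofReal_mul (Real.exp_pos _).le, ← Real.exp_add]
    exact ENNReal.ofReal_le_ofReal (Real.exp_le_exp.2 (by linarith))
  have hearly : M.P ν θ {ω | τ ω ≤ ((ν + N : ℕ) : ℕ∞)} ≤ ENNReal.ofReal (1 - c) := by
    refine le_trans ?_ hs.le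
    have hsub : {ω | τ ω ≤ ((ν + N : ℕ) : ℕ∞)} ⊆ {ω | τ ω ≤ (ν : ℕ∞)} ∪
        {ω | (ν : ℕ∞) < τ ω ∧ τ ω ≤ ((ν + N : ℕ) : ℕ∞)} := by
      intro ω hω
      by_cases h : τ ω ≤ (ν : ℕ∞)
      · exact Or.inl h
      · exact Or.inr ⟨not_le.1 h, hω⟩
    refine (measure_mono hsub).trans ((measure_union_le _ _).trans (add_le_add ?_
      (hwin.trans (add_le_add hA hB))))
    rw [M.P_eq_Pinf ν θ (hle ν)]
    refine (measure_mono fun ω (hω : τ ω ≤ ν) => ?_).trans hfa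
    refine hω.trans ?_
    exact_mod_cast Nat.le_add_right ν N
  have hgo : ENNReal.ofReal c ≤ M.P ν θ {ω | ((ν + N : ℕ) : ℕ∞) < τ ω} := by
    have hcompl : {ω | ((ν + N : ℕ) : ℕ∞) < τ ω} = {ω | τ ω ≤ ((ν + N : ℕ) : ℕ∞)}ᶜ := by
      ext ω; simp
    rw [hcompl, prob_compl_eq_one_sub (M.obsFiltration.le _ _ (hle (ν + N)))]
    calc ENNReal.ofReal c = 1 - ENNReal.ofReal (1 - c) := by
          rw [← ENNReal.ofReal_one, ← ENNReal.ofReal_sub _ (by linarith)]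
          congr 1; ring
      _ ≤ _ := tsub_le_tsub_left hearly 1
  calc ENNReal.ofReal (c ^ 3 * (c ^ 3 * (s / I θ)) ^ q)
      ≤ ENNReal.ofReal ((c ^ 2 * s / I θ) ^ q * c) := by
        refine ENNReal.ofReal_le_ofReal ?_
        rw [mul_comm]
        have h3 : c ^ 3 ≤ c ^ 2 := pow_le_pow_of_le_one hc0.le hc1.le (by norm_num)
        have h31 : c ^ 3 ≤ c := by
          simpa using pow_le_pow_of_le_one hc0.le hc1.le (by norm_num : 1 ≤ 3)
        rw [mul_div_assoc]
        gcongr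
    _ = ENNReal.ofReal (c ^ 2 * s / I θ) ^ q * ENNReal.ofReal c := by
        rw [ENNReal.ofReal_mul (by positivity), ENNReal.ofReal_rpow_of_nonneg (by positivity) hq]
    _ ≤ ENNReal.ofReal (c ^ 2 * s / I θ) ^ q * M.P ν θ {ω | ((ν + N : ℕ) : ℕ∞) < τ ω} := by
        gcongr
    _ = ∫⁻ _ in {ω | ((ν + N : ℕ) : ℕ∞) < τ ω}, ENNReal.ofReal (c ^ 2 * s / I θ) ^ q
          ∂M.P ν θ := by rw [setLIntegral_const]
    _ ≤ ∫⁻ ω in {ω | ((ν + N : ℕ) : ℕ∞) < τ ω}, ((τ ω : ℝ≥0∞) - (ν : ℝ≥0∞)) ^ q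
          ∂M.P ν θ := by
        refine setLIntegral_mono' (M.obsFiltration.le _ _ (hτ.measurableSet_gt (ν + N)))
          fun ω (hω : ((ν + N : ℕ) : ℕ∞) < τ ω) => ?_
        refine ENNReal.rpow_le_rpow ?_ hq
        -- Strictness gains one time unit, which undoes the floor in `N`.
        have h1 : ((ν + N + 1 : ℕ) : ℕ∞) ≤ τ ω := by
          have := Order.add_one_le_of_lt hω
          exact_mod_cast this
        have h2 : ((ν + N + 1 : ℕ) : ℝ≥0∞) ≤ (τ ω : ℝ≥0∞) := by
          simpa using ENat.toENNReal_le.2 h1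
        refine le_trans ?_ (tsub_le_tsub_right h2 _)
        refine ENNReal.le_sub_of_add_le_left (ENNReal.natCast_ne_top ν) ?_
        have h3 : ENNReal.ofReal (c ^ 2 * s / I θ) ≤ ((N + 1 : ℕ) : ℝ≥0∞) := by
          rw [← ENNReal.ofReal_natCast]
          refine ENNReal.ofReal_le_ofReal ?_
          push_cast
          exact (Nat.lt_floor_add_one _).le
        refine (add_le_add le_rfl h3).trans (le_of_eq ?_)
        push_cast
        ring
    _ ≤ ∫⁻ ω in {ω | (ν : ℕ∞) < τ ω}, ((τ ω : ℝ≥0∞) - (ν : ℝ≥0∞)) ^ q ∂M.P ν θ := by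
        refine lintegral_mono_set fun ω (hω : ((ν + N : ℕ) : ℕ∞) < τ ω) => ?_
        refine lt_of_le_of_lt ?_ hω
        exact_mod_cast Nat.le_add_right ν N
    _ ≤ M.risk q ν θ τ := M.setLIntegral_le_risk q ν θ τ

end ChangePointModel

/-! ### Moments of the delay and the upper bound -/

/-- The increment bound for `x ^ q` in a form suited to sums weighted by `x ^ (r - 1)`. -/
theorem Real.succ_rpow_le_rpow_add {q r : ℝ} (hq : 1 ≤ q) (hqr : q ≤ r) (k : ℕ) :
    ((k : ℝ) + 2) ^ q ≤ ((k : ℝ) + 1) ^ q + q * 2 ^ (r - 1) * ((k : ℝ) + 1) ^ (r - 1) := by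
  have hk : (0 : ℝ) ≤ k := Nat.cast_nonneg k
  -- Bernoulli's inequality for `(1 - 1/(k+2))^q`.
  have hb := one_add_mul_self_le_rpow_one_add (s := -(1 / ((k : ℝ) + 2))) (p := q)
    (by rw [neg_le_neg_iff, div_le_one (by positivity)]; linarith) hq
  have h1 : (1 + -(1 / ((k : ℝ) + 2))) = ((k : ℝ) + 1) / (k + 2) := by
    field_simp
    ring
  rw [h1, Real.div_rpow (by positivity) (by positivity)] at hb
  have hp : 0 < ((k : ℝ) + 2) ^ q := by positivity
  have h2 : ((k : ℝ) + 2) ^ q = ((k : ℝ) + 2) ^ (q - 1) * (k + 2) := by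
    rw [← Real.rpow_add_one (by positivity)]
    congr 1
    ring
  have h3 : ((k : ℝ) + 2) ^ q - q * ((k : ℝ) + 2) ^ (q - 1) ≤ ((k : ℝ) + 1) ^ q := by
    rw [le_div_iff₀ hp] at hb
    refine le_trans (le_of_eq ?_) hb
    rw [add_mul, one_mul, h2]
    field_simp
    ring
  have h4 : ((k : ℝ) + 2) ^ (q - 1) ≤ 2 ^ (r - 1) * ((k : ℝ) + 1) ^ (r - 1) := by
    rw [← Real.mul_rpow (by norm_num) (by positivity)]
    calc ((k : ℝ) + 2) ^ (q - 1) ≤ (2 * ((k : ℝ) + 1)) ^ (q - 1) := by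
          gcongr
          linarith
      _ ≤ (2 * ((k : ℝ) + 1)) ^ (r - 1) := by
          gcongr
          linarith
  nlinarith [mul_le_mul_of_nonneg_left h4 (by linarith : (0 : ℝ) ≤ q)]

/-- A discrete layer-cake formula: telescope the `q`-th power from `K + 1` on and bound each
increment by the weight used in `leftTailSeries`. At `⊤` the series diverges, its terms from `K` on
being at least one. -/
theorem ENat.toENNReal_rpow_le {q r : ℝ} (hq : 1 ≤ q) (hqr : q ≤ r) (K : ℕ) (x : ℕ∞) :
    (x : ℝ≥0∞) ^ q ≤ ENNReal.ofReal (((K : ℝ) + 1) ^ q) +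
      ∑' m : ℕ, if K ≤ m ∧ ((m + 1 : ℕ) : ℕ∞) < x then
        ENNReal.ofReal (q * 2 ^ (r - 1) * ((m + 1 : ℕ) : ℝ) ^ (r - 1)) else 0 := by
  have hq0 : 0 < q := by linarith
  by_cases hx : x = ⊤
  · subst hx
    have h : ∑' m : ℕ, (if K ≤ m ∧ ((m + 1 : ℕ) : ℕ∞) < ⊤ then
        ENNReal.ofReal (q * 2 ^ (r - 1) * ((m + 1 : ℕ) : ℝ) ^ (r - 1)) else 0) = ∞ := by
      refine top_unique ?_
      calc (∞ : ℝ≥0∞) = ∑' _ : ℕ, (1 : ℝ≥0∞) := by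
            rw [ENNReal.tsum_const_eq_top_of_ne_zero one_ne_zero]
        _ ≤ ∑' m : ℕ, (if K ≤ m + K ∧ ((m + K + 1 : ℕ) : ℕ∞) < ⊤ then
              ENNReal.ofReal (q * 2 ^ (r - 1) * ((m + K + 1 : ℕ) : ℝ) ^ (r - 1)) else 0) := by
            refine ENNReal.tsum_le_tsum fun m => ?_
            rw [if_pos ⟨Nat.le_add_left _ _, ENat.natCast_lt_top _⟩, ← ENNReal.ofReal_one]
            refine ENNReal.ofReal_le_ofReal ?_
            have h1 : (1 : ℝ) ≤ 2 ^ (r - 1) := Real.one_le_rpow (by norm_num) (by linarith)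
            have h2 : (1 : ℝ) ≤ ((m + K + 1 : ℕ) : ℝ) ^ (r - 1) :=
              Real.one_le_rpow (by push_cast; linarith [(Nat.cast_nonneg m : (0 : ℝ) ≤ m),
                (Nat.cast_nonneg K : (0 : ℝ) ≤ K)]) (by linarith)
            exact one_le_mul_of_one_le_of_one_le (one_le_mul_of_one_le_of_one_le hq h1) h2
        _ ≤ _ := ENNReal.tsum_comp_le_tsum_of_injective (f := fun m : ℕ => m + K)
              (fun a b hab => by simpa using hab)
              (fun m : ℕ => if K ≤ m ∧ ((m + 1 : ℕ) : ℕ∞) < ⊤ then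
                ENNReal.ofReal (q * 2 ^ (r - 1) * ((m + 1 : ℕ) : ℝ) ^ (r - 1)) else 0)
    rw [h, add_top]
    exact le_top
  obtain ⟨n, rfl⟩ := ENat.ne_top_iff_exists.1 hx
  rw [ENat.toENNReal_coe, ← ENNReal.ofReal_natCast,
    ENNReal.ofReal_rpow_of_nonneg (Nat.cast_nonneg n) hq0.le]
  rcases Nat.lt_or_ge n (K + 1) with hn | hn
  · refine le_add_right (ENNReal.ofReal_le_ofReal ?_)
    have h1 : (n : ℝ) ≤ (K : ℝ) + 1 := by exact_mod_cast hn.le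
    gcongr
  have key : ∀ k : ℕ, K ≤ k → ENNReal.ofReal (((k : ℝ) + 1) ^ q) ≤
      ENNReal.ofReal (((K : ℝ) + 1) ^ q) + ∑ m ∈ Finset.Ico K k,
        ENNReal.ofReal (q * 2 ^ (r - 1) * ((m + 1 : ℕ) : ℝ) ^ (r - 1)) := by
    intro k hk
    induction k, hk using Nat.le_induction with
    | base => simp
    | succ k hk ih =>
      rw [Finset.sum_Ico_succ_top hk, ← add_assoc]
      refine le_trans ?_ (add_le_add_left ih _)
      rw [← ENNReal.ofReal_add (by positivity) (by positivity)]
      refine ENNReal.ofReal_le_ofReal ?_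
      have := Real.succ_rpow_le_rpow_add hq hqr k
      push_cast
      rwa [add_assoc (k : ℝ) 1 1, one_add_one_eq_two]
  obtain ⟨k, rfl⟩ : ∃ k, n = k + 1 := ⟨n - 1, by omega⟩
  push_cast
  refine (key k (by omega)).trans (add_le_add le_rfl ?_)
  refine le_trans (Finset.sum_le_sum fun m hm => ?_)
    (ENNReal.sum_le_tsum (Finset.Ico K k))
  obtain ⟨h1, h2⟩ := Finset.mem_Ico.1 hm
  rw [if_pos ⟨h1, by exact_mod_cast Nat.succ_lt_succ h2⟩]
  push_cast
  exact le_rfl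

namespace ChangePointModel

variable {Θ Ω 𝒳 : Type*} [MetricSpace Θ] [MeasurableSpace Θ] [BorelSpace Θ]
  [mΩ : MeasurableSpace Ω] [MeasurableSpace 𝒳]

/-- Restricting the mixture to the ball and the sum to `k = ν` costs only the additive constant `log
W(ball)`. -/
theorem le_log_WSR (M : ChangePointModel Θ Ω 𝒳) (W : Measure Θ) [IsProbabilityMeasure W]
    {θ : Θ} {δ : ℝ} (hW : 0 < W (Metric.ball θ δ)) (ν n : ℕ) (hn : 1 ≤ n) (ω : Ω) {J a : ℝ}
    (ha : a - Real.log (W (Metric.ball θ δ)).toReal ≤ n * J)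
    (h : (J : EReal) ≤ (⨅ u ∈ Metric.ball θ δ, M.Z ν (ν + n) u ω) / (n : EReal)) :
    (a : EReal) ≤ ENNReal.log (M.WSR W (ν + n) ω) := by
  have hw : 0 < (W (Metric.ball θ δ)).toReal := ENNReal.toReal_pos hW.ne' (measure_ne_top _ _)
  rw [EReal.le_div_iff_mul_le (by exact_mod_cast hn) (EReal.natCast_ne_top n)] at h
  have hLR : ∀ u ∈ Metric.ball θ δ, ENNReal.ofReal (Real.exp (n * J)) ≤ M.LR ν (ν + n) u ω := by
    intro u hu
    have h1 := EReal.exp_le_exp_iff.2 (h.trans (iInf₂_le u hu))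
    rw [Z_eq_log_LR, ENNReal.exp_log] at h1
    rwa [← EReal.exp_coe, mul_comm, EReal.coe_mul]
  have h2 : ENNReal.ofReal (Real.exp a) ≤ M.WSR W (ν + n) ω := by
    calc ENNReal.ofReal (Real.exp a)
        ≤ ENNReal.ofReal (Real.exp (n * J) * (W (Metric.ball θ δ)).toReal) := by
          refine ENNReal.ofReal_le_ofReal ?_
          refine le_trans ?_ (le_of_eq (congrArg (Real.exp (n * J) * ·) (Real.exp_log hw)))
          rw [← Real.exp_add]
          exact Real.exp_le_exp.2 (by linarith)
      _ = ENNReal.ofReal (Real.exp (n * J)) * W (Metric.ball θ δ) := by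
          rw [ENNReal.ofReal_mul (Real.exp_pos _).le, ENNReal.ofReal_toReal (measure_ne_top _ _)]
      _ = ∫⁻ _ in Metric.ball θ δ, ENNReal.ofReal (Real.exp (n * J)) ∂W := by
          rw [setLIntegral_const]
      _ ≤ ∫⁻ u in Metric.ball θ δ, M.LR ν (ν + n) u ω ∂W :=
          setLIntegral_mono' measurableSet_ball hLR
      _ ≤ ∫⁻ u, M.LR ν (ν + n) u ω ∂W := setLIntegral_le_lintegral _ _
      _ ≤ M.WSR W (ν + n) ω := by
          refine lintegral_mono fun u => ?_
          exact Finset.single_le_sum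
            (f := fun k => ∏ i ∈ Finset.Ico k (ν + n), M.ratio k u i ω)
            (fun _ _ => zero_le) (Finset.mem_range.2 (by omega))
  have h3 := ENNReal.log_le_log h2
  rwa [ENNReal.log_ofReal_of_pos (Real.exp_pos a), Real.log_exp] at h3

/-- A moment bound for the detection delay, valid for every threshold and change point. -/
theorem lintegral_T_sub_rpow_le (M : ChangePointModel Θ Ω 𝒳) (W : Measure Θ)
    [IsProbabilityMeasure W] {I : Θ → ℝ} {θ : Θ} {δ ε r q a : ℝ}
    (hW : 0 < W (Metric.ball θ δ)) (hq : 1 ≤ q) (hqr : q ≤ r) (hεI : ε < I θ) {K : ℕ}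
    (hK : a - Real.log (W (Metric.ball θ δ)).toReal ≤ (K + 1) * (I θ - ε)) (ν : ℕ) :
    ∫⁻ ω, ((M.T W a ω : ℝ≥0∞) - (ν : ℝ≥0∞)) ^ q ∂M.P ν θ ≤
      ENNReal.ofReal (((K : ℝ) + 1) ^ q) +
        ENNReal.ofReal (q * 2 ^ (r - 1)) * M.leftTailSeries I r ε θ δ := by
  have := M.isProbabilityMeasure_P ν θ
  have hτ := M.isStoppingTime_T W a
  have hgt : ∀ n : ℕ, MeasurableSet {ω | (n : ℕ∞) < M.T W a ω} :=
    fun n => M.obsFiltration.le n _ (hτ.measurableSet_gt n)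
  set d : ℕ → ℝ≥0∞ := fun m =>
    ENNReal.ofReal (q * 2 ^ (r - 1) * ((m + 1 : ℕ) : ℝ) ^ (r - 1)) with hd
  set A : ℕ → Set Ω := fun m => {ω | ((ν + (m + 1) : ℕ) : ℕ∞) < M.T W a ω} with hA
  have hpt : ∀ ω, ((M.T W a ω : ℝ≥0∞) - (ν : ℝ≥0∞)) ^ q ≤ ENNReal.ofReal (((K : ℝ) + 1) ^ q) +
      ∑' m : ℕ, (A m).indicator (fun _ => if K ≤ m then d m else 0) ω := by
    intro ω
    have h := ENat.toENNReal_rpow_le hq hqr K (M.T W a ω - ν)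
    rw [ENat.toENNReal_sub, ENat.toENNReal_coe] at h
    refine h.trans (add_le_add le_rfl (ENNReal.tsum_le_tsum fun m => ?_))
    by_cases hm : K ≤ m ∧ ((m + 1 : ℕ) : ℕ∞) < M.T W a ω - ν
    · have hmem : ω ∈ A m := by
        have h1 := lt_tsub_iff_left.1 hm.2
        change ((ν + (m + 1) : ℕ) : ℕ∞) < M.T W a ω
        exact_mod_cast h1
      rw [if_pos hm, Set.indicator_of_mem hmem, if_pos hm.1]
    · rw [if_neg hm]
      exact zero_le
  refine (lintegral_mono hpt).trans ?_
  rw [lintegral_add_left measurable_const, lintegral_const, measure_univ, mul_one]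
  refine add_le_add le_rfl ?_
  rw [lintegral_tsum fun m => (measurable_const.indicator (hgt _)).aemeasurable, leftTailSeries,
    ← ENNReal.tsum_mul_left]
  refine ENNReal.tsum_le_tsum fun m => ?_
  rw [lintegral_indicator_const (hgt _)]
  split_ifs with hm
  · rw [← mul_assoc, ← ENNReal.ofReal_mul (by positivity)]
    refine mul_le_mul_right ?_ _
    refine le_trans (measure_mono fun ω hω => ?_) (le_iSup (fun ν => M.P ν θ
      {ω | (⨅ u ∈ Metric.ball θ δ, M.Z ν (ν + (m + 1)) u ω) / ((m + 1 : ℕ) : EReal)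
        < ((I θ - ε : ℝ) : EReal)}) ν)
    rw [Set.mem_ofPred_eq]
    -- Otherwise the whole ball has large `Z`, and since `m ≥ K` this forces an alarm by `ν + m +
    -- 1`.
    by_contra hcon
    have hm' : ((K : ℝ) + 1) ≤ ((m + 1 : ℕ) : ℝ) := by exact_mod_cast Nat.succ_le_succ hm
    have hlog := M.le_log_WSR W hW ν (m + 1) (Nat.le_add_left 1 m) ω
      (hK.trans (mul_le_mul_of_nonneg_right hm' (by linarith))) (not_lt.1 hcon)
    have hle := (M.T_le_iff W a ω (ν + (m + 1))).2 ⟨_, le_rfl, by omega, hlog⟩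
    exact absurd hω (not_lt.2 hle)
  · simp

/-- The asymptotic upper bound for the risk of the weighted Shiryaev–Roberts procedure, uniform
over the change points with a small local false alarm probability. -/
theorem risk_T_le (M : ChangePointModel Θ Ω 𝒳) (W : Measure Θ) [IsProbabilityMeasure W]
    {θ : Θ} (hW : ∀ δ : ℝ, 0 < δ → 0 < W (Metric.ball θ δ)) {I : Θ → ℝ} (hI : 0 < I θ)
    {r q : ℝ} (hA2 : M.LeftTail I r) (hq : 1 ≤ q) (hqr : q ≤ r) {c : ℝ} (hc : 1 < c) :
    ∀ᶠ a : ℝ in atTop, ∀ ν : ℕ, ν * Real.exp (-a) ≤ 1 - 1 / c →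
      M.risk q ν θ (M.T W a) ≤ ENNReal.ofReal (c ^ 2 * (c ^ 2 * (a / I θ)) ^ q) := by
  have hc0 : 0 < c := by linarith
  -- With this `ε` the guaranteed rate `I - ε` is `I / c`. A single `δ` with finite series then
  -- suffices.
  have hε : 0 < I θ - I θ / c := by
    rw [sub_pos, div_lt_iff₀ hc0]
    nlinarith
  obtain ⟨L, hL, hlim⟩ := hA2 θ _ hε
  obtain ⟨δ, hδL, hδ⟩ := ((hlim.eventually (gt_mem_nhds hL)).and
    (self_mem_nhdsWithin (s := Set.Ioi (0 : ℝ)))).exists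
  set S : ℝ≥0∞ := ENNReal.ofReal (q * 2 ^ (r - 1)) *
    M.leftTailSeries I r (I θ - I θ / c) θ δ with hS
  have hSfin : S ≠ ∞ := ENNReal.mul_ne_top ENNReal.ofReal_ne_top hδL.ne
  set w : ℝ := Real.log (W (Metric.ball θ δ)).toReal with hw
  have hy : Tendsto (fun a : ℝ => a / I θ) atTop atTop := tendsto_id.atTop_div_const hI
  have hpow : Tendsto (fun a : ℝ => (c - 1) * (c ^ 2 * (a / I θ)) ^ q) atTop atTop :=
    ((tendsto_rpow_atTop (by linarith)).comp
      (hy.const_mul_atTop (by positivity))).const_mul_atTop (by linarith)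
  -- The gap between `c a / I` and `c² a / I` absorbs the constant `w` and the rounding in `K`.
  have hcc : 0 < c ^ 2 - c := by nlinarith
  filter_upwards [hpow.eventually_ge_atTop S.toReal, eventually_gt_atTop 0,
    eventually_ge_atTop w, (hy.const_mul_atTop hcc).eventually_ge_atTop (2 - w * c / I θ)]
    with a haS ha0 haw ha2 ν hν
  have hPi := M.isProbabilityMeasure_Pinf
  have hP := M.isProbabilityMeasure_P ν θ
  have hτ := M.isStoppingTime_T W a
  have hle : MeasurableSet[M.obsFiltration ν] {ω | M.T W a ω ≤ (ν : ℕ∞)} := hτ ν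
  set K : ℕ := ⌈(a - w) * c / I θ⌉₊ with hKdef
  have hK1 : (a - w) * c / I θ ≤ K := Nat.le_ceil _
  have hK2 : (K : ℝ) < (a - w) * c / I θ + 1 :=
    Nat.ceil_lt_add_one (div_nonneg (mul_nonneg (by linarith) hc0.le) hI.le)
  have hK : a - w ≤ (K + 1) * (I θ - (I θ - I θ / c)) := by
    rw [sub_sub_cancel]
    have h1 : (a - w) * c / I θ ≤ K + 1 := by linarith
    rw [div_le_iff₀ hI] at h1
    rw [← mul_div_assoc, le_div_iff₀ hc0]
    exact h1
  have hKc : (K : ℝ) + 1 ≤ c ^ 2 * (a / I θ) := by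
    have h1 : (a - w) * c / I θ = c * (a / I θ) - w * c / I θ := by ring
    nlinarith
  have hint := M.lintegral_T_sub_rpow_le W (I := I) (hW δ hδ) hq hqr
    (by linarith [div_pos hI hc0]) hK ν
  have hy0 : 0 ≤ (c ^ 2 * (a / I θ)) ^ q := by positivity
  have hint' : ∫⁻ ω, ((M.T W a ω : ℝ≥0∞) - (ν : ℝ≥0∞)) ^ q ∂M.P ν θ
      ≤ ENNReal.ofReal (c * (c ^ 2 * (a / I θ)) ^ q) := by
    refine hint.trans ?_
    rw [← hS, ← ENNReal.ofReal_toReal hSfin, ← ENNReal.ofReal_add (by positivity)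
      ENNReal.toReal_nonneg]
    refine ENNReal.ofReal_le_ofReal ?_
    have h1 : ((K : ℝ) + 1) ^ q ≤ (c ^ 2 * (a / I θ)) ^ q := by gcongr
    linarith
  -- Having no alarm by `ν` is a pre-change event, so the local false alarm bound applies to the
  -- conditioning probability.
  have hprob : ENNReal.ofReal (1 / c) ≤ M.P ν θ {ω | (ν : ℕ∞) < M.T W a ω} := by
    have hcompl : {ω | (ν : ℕ∞) < M.T W a ω} = {ω | M.T W a ω ≤ (ν : ℕ∞)}ᶜ := by
      ext ω; simp
    rw [hcompl, prob_compl_eq_one_sub (M.obsFiltration.le _ _ hle), M.P_eq_Pinf ν θ hle]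
    refine le_trans ?_ (tsub_le_tsub_left ((M.Pinf_T_le W a ν).trans
      (ENNReal.ofReal_le_ofReal hν)) 1)
    rw [← ENNReal.ofReal_one, ← ENNReal.ofReal_sub _
      (by rw [sub_nonneg, div_le_one hc0]; exact hc.le), sub_sub_cancel]
  unfold risk ProbabilityTheory.cond
  rw [lintegral_smul_measure, smul_eq_mul]
  calc (M.P ν θ {ω | (ν : ℕ∞) < M.T W a ω})⁻¹ *
        ∫⁻ ω in {ω | (ν : ℕ∞) < M.T W a ω}, ((M.T W a ω : ℝ≥0∞) - (ν : ℝ≥0∞)) ^ q ∂M.P ν θ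
      ≤ (ENNReal.ofReal (1 / c))⁻¹ * ENNReal.ofReal (c * (c ^ 2 * (a / I θ)) ^ q) :=
        mul_le_mul' (ENNReal.inv_le_inv.2 hprob) ((setLIntegral_le_lintegral _ _).trans hint')
    _ = ENNReal.ofReal (c ^ 2 * (c ^ 2 * (a / I θ)) ^ q) := by
        rw [← ENNReal.ofReal_inv_of_pos (by positivity), ← ENNReal.ofReal_mul (by positivity)]
        congr 1
        rw [one_div, inv_inv]
        ring

end ChangePointModel

/-! ### Thresholds and risk bounds in terms of `|log α|` -/

theorem Real.tendsto_abs_log_nhdsGT_zero :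
    Tendsto (fun α : ℝ => |Real.log α|) (𝓝[>] 0) atTop :=
  tendsto_abs_atBot_atTop.comp Real.tendsto_log_nhdsGT_zero

theorem tendsto_atTop_of_div_abs_log {a : ℝ → ℝ}
    (ha : Tendsto (fun α => a α / |Real.log α|) (𝓝[>] 0) (𝓝 1)) :
    Tendsto a (𝓝[>] 0) atTop := by
  refine (ha.pos_mul_atTop one_pos Real.tendsto_abs_log_nhdsGT_zero).congr' ?_
  filter_upwards [Real.tendsto_abs_log_nhdsGT_zero.eventually_gt_atTop 0] with α hα
  exact div_mul_cancel₀ _ hα.ne'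

/-- The threshold `log [(1 - ϱ_α) / (ϱ_α α)]` is asymptotically `|log α|`. -/
theorem tendsto_log_threshold_div {ϱ : ℝ → ℝ}
    (hϱ : ∀ α ∈ Set.Ioo (0 : ℝ) 1, ϱ α ∈ Set.Ioo (0 : ℝ) 1)
    (hϱ_zero : Tendsto ϱ (𝓝[>] 0) (𝓝 0))
    (hϱ_log : Tendsto (fun α => |Real.log (ϱ α)| / |Real.log α|) (𝓝[>] 0) (𝓝 0)) :
    Tendsto (fun α => Real.log ((1 - ϱ α) / (ϱ α * α)) / |Real.log α|) (𝓝[>] 0) (𝓝 1) := by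
  have h1 : Tendsto (fun α => Real.log (1 - ϱ α)) (𝓝[>] 0) (𝓝 0) := by
    have h : Tendsto (fun α => 1 - ϱ α) (𝓝[>] 0) (𝓝 1) := by
      simpa using hϱ_zero.const_sub 1
    simpa using h.log one_ne_zero
  have h2 := h1.div_atTop Real.tendsto_abs_log_nhdsGT_zero
  have h3 := (h2.add hϱ_log).add_const 1
  rw [add_zero, zero_add] at h3
  refine h3.congr' ?_
  filter_upwards [Ioo_mem_nhdsGT (zero_lt_one (α := ℝ))] with α hα
  obtain ⟨hp0, hp1⟩ := hϱ α hα
  have hlog : Real.log α < 0 := Real.log_neg hα.1 hα.2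
  rw [Real.log_div (by linarith) (mul_pos hp0 hα.1).ne', Real.log_mul hp0.ne' hα.1.ne',
    abs_of_neg hlog, abs_of_neg (Real.log_neg hp0 hp1)]
  have : Real.log α ≠ 0 := hlog.ne
  field_simp
  ring

namespace ChangePointModel

section Lower

variable {Θ Ω 𝒳 : Type*} [MeasurableSpace Θ] [mΩ : MeasurableSpace Ω] [MeasurableSpace 𝒳]

/-- Since `ϱ → 0` and the window is `O(|log α|)`, the factor `(1 - ϱ)^{-(ν + N)}` is only `e^{o(|log
α|)}`. The bound is uniform over the class, so it survives the infimum. -/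
theorem le_risk_of_mem_Delta (M : ChangePointModel Θ Ω 𝒳) {I : Θ → ℝ} (hA1 : M.RightTail I)
    {θ : Θ} (hI : 0 < I θ) {q : ℝ} (hq : 0 ≤ q) (ν : ℕ) {ϱ : ℝ → ℝ}
    (hϱ : ∀ α ∈ Set.Ioo (0 : ℝ) 1, ϱ α ∈ Set.Ioo (0 : ℝ) 1)
    (hϱ_zero : Tendsto ϱ (𝓝[>] 0) (𝓝 0)) {c : ℝ} (hc : c ∈ Set.Ioo (0 : ℝ) 1) :
    ∀ᶠ α in 𝓝[>] (0 : ℝ), ∀ τ ∈ M.Delta α (ϱ α),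
      ENNReal.ofReal (c ^ 3 * (c ^ 3 * (|Real.log α| / I θ)) ^ q) ≤ M.risk q ν θ τ := by
  -- Chosen so that `η (ν + N) ≤ (1 - c)/2 · s` when `ν ≤ s`, exactly the room between exponents `1`
  -- and `(1 + c)/2`.
  set η : ℝ := (1 - c) / 2 / (1 + c ^ 2 / I θ) with hη
  have hden : 0 < 1 + c ^ 2 / I θ := by positivity
  have hη0 : 0 < η := div_pos (by linarith [hc.2]) hden
  have hηp : Tendsto (fun α => 1 - ϱ α) (𝓝[>] 0) (𝓝 1) := by
    simpa using hϱ_zero.const_sub 1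
  have hlog := Real.tendsto_abs_log_nhdsGT_zero
  filter_upwards [hlog.eventually (M.le_risk_of_Pinf_le hA1 hI hq ν hc),
    hηp.eventually (lt_mem_nhds (by simpa using hη0 : Real.exp (-η) < 1)),
    hlog.eventually_ge_atTop (ν : ℝ), hlog.eventually_gt_atTop 0,
    Ioo_mem_nhdsGT (zero_lt_one (α := ℝ))] with α hα hp hν hs hα01 τ hτ
  refine hα τ hτ.1 ((M.Pinf_le_of_PFA_le (hϱ α hα01) hτ.2 _).trans
    (ENNReal.ofReal_le_ofReal ?_))
  set s := |Real.log α| with hsdef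
  set N := ⌊c ^ 2 * s / I θ⌋₊
  have hNle : (N : ℝ) ≤ c ^ 2 * s / I θ := Nat.floor_le (by positivity)
  have hαs : α = Real.exp (-s) := by
    rw [hsdef, abs_of_neg (Real.log_neg hα01.1 hα01.2), neg_neg, Real.exp_log hα01.1]
  have hpow : Real.exp (-(η * ((ν : ℝ) + N))) ≤ (1 - ϱ α) ^ (ν + N) := by
    calc Real.exp (-(η * ((ν : ℝ) + N))) = Real.exp (-η) ^ (ν + N) := by
          rw [← Real.exp_nat_mul]
          congr 1
          push_cast
          ring
      _ ≤ _ := pow_le_pow_left₀ (Real.exp_pos _).le hp.le _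
  have hbound : η * ((ν : ℝ) + N) ≤ (1 - c) / 2 * s := by
    calc η * ((ν : ℝ) + N) ≤ η * (s + c ^ 2 * s / I θ) := by gcongr
      _ = η * (1 + c ^ 2 / I θ) * s := by ring
      _ = (1 - c) / 2 * s := by rw [hη, div_mul_cancel₀ _ hden.ne']
  rw [div_le_iff₀ (lt_of_lt_of_le (Real.exp_pos _) hpow)]
  refine le_trans ?_ (mul_le_mul_of_nonneg_left hpow (Real.exp_pos _).le)
  rw [← Real.exp_add]
  nth_rewrite 1 [hαs]
  exact Real.exp_le_exp.2 (by linarith)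

theorem le_risk_T (M : ChangePointModel Θ Ω 𝒳) (W : Measure Θ) [IsProbabilityMeasure W]
    {I : Θ → ℝ} (hA1 : M.RightTail I)
    {θ : Θ} (hI : 0 < I θ) {q : ℝ} (hq : 0 ≤ q) (ν : ℕ) {c : ℝ} (hc : c ∈ Set.Ioo (0 : ℝ) 1) :
    ∀ᶠ a : ℝ in atTop,
      ENNReal.ofReal (c ^ 3 * (c ^ 3 * (a / I θ)) ^ q) ≤ M.risk q ν θ (M.T W a) := by
  have hk : 0 < (1 - c) / 2 := by linarith [hc.2]
  set k := (1 - c) / 2 with hkdef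
  -- The last threshold lets the quadratic term of `e^{ka}` dominate `ν + N ≤ (1 + c²/I) a`.
  filter_upwards [M.le_risk_of_Pinf_le hA1 hI hq ν hc, eventually_ge_atTop (ν : ℝ),
    eventually_gt_atTop 0, eventually_ge_atTop (2 * (1 + c ^ 2 / I θ) / k ^ 2)]
    with a ha hν ha0 hak
  refine ha _ (M.isStoppingTime_T W a) ((M.Pinf_T_le W a _).trans (ENNReal.ofReal_le_ofReal ?_))
  set N := ⌊c ^ 2 * a / I θ⌋₊
  have hNle : (N : ℝ) ≤ c ^ 2 * a / I θ := Nat.floor_le (by positivity)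
  have h1 : ((ν + N : ℕ) : ℝ) ≤ Real.exp (k * a) := by
    rw [div_le_iff₀ (by positivity)] at hak
    calc ((ν + N : ℕ) : ℝ) ≤ a + c ^ 2 * a / I θ := by push_cast; linarith
      _ = 2 * (1 + c ^ 2 / I θ) * a / 2 := by ring
      _ ≤ a * k ^ 2 * a / 2 := by gcongr
      _ = (k * a) ^ 2 / 2 := by ring
      _ ≤ 1 + k * a + (k * a) ^ 2 / 2 := by
          have : 0 ≤ k * a := by positivity
          linarith
      _ ≤ Real.exp (k * a) := Real.quadratic_le_exp_of_nonneg (by positivity)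
  calc ((ν + N : ℕ) : ℝ) * Real.exp (-a) ≤ Real.exp (k * a) * Real.exp (-a) := by gcongr
    _ = Real.exp (-((1 + c) / 2 * a)) := by
        rw [← Real.exp_add]
        congr 1
        rw [hkdef]
        ring

end Lower

variable {Θ Ω 𝒳 : Type*} [MetricSpace Θ] [MeasurableSpace Θ] [BorelSpace Θ]
  [mΩ : MeasurableSpace Ω] [MeasurableSpace 𝒳]

/-- Replacing `a` by `|log α|` costs one more factor `c`, whence the cubes. -/
theorem risk_T_le_of_div_abs_log (M : ChangePointModel Θ Ω 𝒳) (W : Measure Θ)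
    [IsProbabilityMeasure W]
    {θ : Θ} (hW : ∀ δ : ℝ, 0 < δ → 0 < W (Metric.ball θ δ)) {I : Θ → ℝ} (hI : 0 < I θ)
    {r q : ℝ} (hA2 : M.LeftTail I r) (hq : 1 ≤ q) (hqr : q ≤ r) {a : ℝ → ℝ}
    (ha : Tendsto (fun α => a α / |Real.log α|) (𝓝[>] 0) (𝓝 1)) {c : ℝ} (hc : 1 < c) :
    ∀ᶠ α in 𝓝[>] (0 : ℝ), ∀ ν : ℕ, ν * Real.exp (-a α) ≤ 1 - 1 / c →
      M.risk q ν θ (M.T W (a α))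
        ≤ ENNReal.ofReal (c ^ 3 * (c ^ 3 * (|Real.log α| / I θ)) ^ q) := by
  have hat := tendsto_atTop_of_div_abs_log ha
  filter_upwards [hat.eventually (M.risk_T_le W hW hI hA2 hq hqr hc),
    ha.eventually (gt_mem_nhds hc), hat.eventually_ge_atTop 0,
    Real.tendsto_abs_log_nhdsGT_zero.eventually_gt_atTop 0] with α h hac ha0 hs ν hν
  refine (h ν hν).trans (ENNReal.ofReal_le_ofReal ?_)
  rw [div_lt_iff₀ hs] at hac
  have hc0 : 0 < c := by linarith
  have h1 : c ^ 2 * (a α / I θ) ≤ c ^ 3 * (|Real.log α| / I θ) := by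
    calc c ^ 2 * (a α / I θ) ≤ c ^ 2 * (c * |Real.log α| / I θ) := by gcongr
      _ = _ := by ring
  have h2 : c ^ 2 ≤ c ^ 3 := pow_le_pow_right₀ hc.le (by norm_num)
  gcongr

end ChangePointModel

/-! ### Assembly: pointwise and minimax optimality -/

theorem mainTheorem5 {Θ Ω 𝒳 : Type*} [MetricSpace Θ] [MeasurableSpace Θ] [BorelSpace Θ]
    [MeasurableSpace Ω] [MeasurableSpace 𝒳] (M : ChangePointModel Θ Ω 𝒳)
    (W : Measure Θ) [IsProbabilityMeasure W]
    (hW : ∀ (θ : Θ) (δ : ℝ), 0 < δ → 0 < W {u | dist u θ < δ})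
    (r : ℝ) (hr : 1 ≤ r)
    (I : Θ → ℝ) (hI_pos : ∀ θ, 0 < I θ) (hI_cont : Continuous I)
    (hA1 : M.RightTail I) (hA2 : M.LeftTail I r)
    (ϱ : ℝ → ℝ) (hϱ : ∀ α ∈ Set.Ioo (0 : ℝ) 1, ϱ α ∈ Set.Ioo (0 : ℝ) 1)
    (hϱ_zero : Tendsto ϱ (𝓝[>] 0) (𝓝 0))
    (hϱ_log : Tendsto (fun α => |Real.log (ϱ α)| / |Real.log α|) (𝓝[>] 0) (𝓝 0)) :
    -- the particular threshold `log [(1 - ϱ_α) / (ϱ_α α)]` is admissible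
    (∀ α ∈ Set.Ioo (0 : ℝ) 1,
      M.T W (Real.log ((1 - ϱ α) / (ϱ α * α))) ∈ M.Delta α (ϱ α)) ∧
    Tendsto (fun α => Real.log ((1 - ϱ α) / (ϱ α * α)) / |Real.log α|) (𝓝[>] 0) (𝓝 1) ∧
    -- the asymptotics hold for all moments up to order `r`
    ∀ q : ℝ, 1 ≤ q → q ≤ r →
      -- (i), the risk of the procedure as the threshold tends to infinity
      (∀ (θ : Θ) (ν : ℕ),
        RatioEquiv atTop (fun a : ℝ => M.risk q ν θ (M.T W a))
          (fun a => ENNReal.ofReal ((a / I θ) ^ q))) ∧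
      -- (i), pointwise optimality
      (∀ a : ℝ → ℝ,
        (∀ᶠ α in 𝓝[>] (0 : ℝ), M.PFA (ϱ α) (M.T W (a α)) ≤ ENNReal.ofReal α) →
        Tendsto (fun α => a α / |Real.log α|) (𝓝[>] 0) (𝓝 1) →
        ∀ (θ : Θ) (ν : ℕ),
          RatioEquiv (𝓝[>] (0 : ℝ)) (fun α => ⨅ τ ∈ M.Delta α (ϱ α), M.risk q ν θ τ)
            (fun α => ENNReal.ofReal ((|Real.log α| / I θ) ^ q)) ∧
          RatioEquiv (𝓝[>] (0 : ℝ)) (fun α => ENNReal.ofReal ((|Real.log α| / I θ) ^ q))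
            (fun α => M.risk q ν θ (M.T W (a α)))) ∧
      -- (ii), minimax optimality over the change points `ν ≤ k*_α`
      (∀ k : ℝ → ℝ, Tendsto k (𝓝[>] 0) atTop →
        Tendsto (fun α => α * ϱ α * k α) (𝓝[>] 0) (𝓝 0) →
        -- for the particular threshold
        (∀ θ : Θ,
          RatioEquiv (𝓝[>] (0 : ℝ))
            (fun α => ⨅ τ ∈ M.Delta α (ϱ α), ⨆ (ν : ℕ) (_ : (ν : ℝ) ≤ k α), M.risk q ν θ τ)
            (fun α => ENNReal.ofReal ((|Real.log α| / I θ) ^ q)) ∧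
          RatioEquiv (𝓝[>] (0 : ℝ)) (fun α => ENNReal.ofReal ((|Real.log α| / I θ) ^ q))
            (fun α => ⨆ (ν : ℕ) (_ : (ν : ℝ) ≤ k α),
              M.risk q ν θ (M.T W (Real.log ((1 - ϱ α) / (ϱ α * α)))))) ∧
        -- for a general threshold
        (∀ a : ℝ → ℝ,
          (∀ᶠ α in 𝓝[>] (0 : ℝ), M.PFA (ϱ α) (M.T W (a α)) ≤ ENNReal.ofReal α) →
          Tendsto (fun α => a α / |Real.log α|) (𝓝[>] 0) (𝓝 1) →
          Tendsto (fun α => k α * Real.exp (-a α)) (𝓝[>] 0) (𝓝 0) →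
          ∀ θ : Θ,
            RatioEquiv (𝓝[>] (0 : ℝ))
              (fun α => ⨅ τ ∈ M.Delta α (ϱ α), ⨆ (ν : ℕ) (_ : (ν : ℝ) ≤ k α), M.risk q ν θ τ)
              (fun α => ENNReal.ofReal ((|Real.log α| / I θ) ^ q)) ∧
            RatioEquiv (𝓝[>] (0 : ℝ)) (fun α => ENNReal.ofReal ((|Real.log α| / I θ) ^ q))
              (fun α => ⨆ (ν : ℕ) (_ : (ν : ℝ) ≤ k α), M.risk q ν θ (M.T W (a α))))) := by
  have hWb : ∀ (θ : Θ) (δ : ℝ), 0 < δ → 0 < W (Metric.ball θ δ) := hW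
  have ha₀ := tendsto_log_threshold_div hϱ hϱ_zero hϱ_log
  have hlog := Real.tendsto_abs_log_nhdsGT_zero
  have hypos : ∀ θ, ∀ᶠ α in 𝓝[>] (0 : ℝ), 0 < |Real.log α| / I θ := fun θ =>
    (hlog.eventually_gt_atTop 0).mono fun α hα => div_pos hα (hI_pos θ)
  have hne : ∀ (q : ℝ) (θ : Θ), ∀ᶠ α in 𝓝[>] (0 : ℝ),
      ENNReal.ofReal ((|Real.log α| / I θ) ^ q) ≠ 0 ∧
        ENNReal.ofReal ((|Real.log α| / I θ) ^ q) ≠ ∞ := fun q θ =>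
    (hypos θ).mono fun α hα =>
      ⟨by simpa using Real.rpow_pos_of_pos hα q, ENNReal.ofReal_ne_top⟩
  have hΔ₀ : ∀ α ∈ Set.Ioo (0 : ℝ) 1,
      M.T W (Real.log ((1 - ϱ α) / (ϱ α * α))) ∈ M.Delta α (ϱ α) := fun α hα =>
    M.T_mem_Delta W hα.1 (hϱ α hα)
  refine ⟨hΔ₀, ha₀, fun q hq hqr => ?_⟩
  have hq0 : 0 ≤ q := by linarith
  have hsub : ∀ c : ℝ, 1 < c → 0 < 1 - 1 / c := fun c hc => by
    rw [sub_pos, div_lt_one (by linarith)]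
    exact hc
  have hmini : ∀ k : ℝ → ℝ, Tendsto k (𝓝[>] 0) atTop → ∀ a : ℝ → ℝ,
      (∀ᶠ α in 𝓝[>] (0 : ℝ), M.PFA (ϱ α) (M.T W (a α)) ≤ ENNReal.ofReal α) →
      Tendsto (fun α => a α / |Real.log α|) (𝓝[>] 0) (𝓝 1) →
      Tendsto (fun α => k α * Real.exp (-a α)) (𝓝[>] 0) (𝓝 0) →
      ∀ θ : Θ,
        RatioEquiv (𝓝[>] (0 : ℝ))
          (fun α => ⨅ τ ∈ M.Delta α (ϱ α), ⨆ (ν : ℕ) (_ : (ν : ℝ) ≤ k α), M.risk q ν θ τ)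
          (fun α => ENNReal.ofReal ((|Real.log α| / I θ) ^ q)) ∧
        RatioEquiv (𝓝[>] (0 : ℝ)) (fun α => ENNReal.ofReal ((|Real.log α| / I θ) ^ q))
          (fun α => ⨆ (ν : ℕ) (_ : (ν : ℝ) ≤ k α), M.risk q ν θ (M.T W (a α))) := by
    intro k hk a hPFA ha hka θ
    have hlow : ∀ c ∈ Set.Ioo (0 : ℝ) 1, ∀ᶠ α in 𝓝[>] (0 : ℝ), ∀ τ ∈ M.Delta α (ϱ α),
        ENNReal.ofReal (c ^ 3 * (c ^ 3 * (|Real.log α| / I θ)) ^ q) ≤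
          ⨆ (ν : ℕ) (_ : (ν : ℝ) ≤ k α), M.risk q ν θ τ := by
      intro c hc
      -- The change point `ν = 0` alone already gives the minimax lower bound.
      filter_upwards [M.le_risk_of_mem_Delta hA1 (hI_pos θ) hq0 0 hϱ hϱ_zero hc,
        hk.eventually_ge_atTop 0] with α hα hkα τ hτ
      exact (hα τ hτ).trans (le_iSup₂ (f := fun (ν : ℕ) (_ : (ν : ℝ) ≤ k α) => M.risk q ν θ τ) 0
        (by simpa using hkα))
    have hup : ∀ c : ℝ, 1 < c → ∀ᶠ α in 𝓝[>] (0 : ℝ),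
        (⨆ (ν : ℕ) (_ : (ν : ℝ) ≤ k α), M.risk q ν θ (M.T W (a α))) ≤
          ENNReal.ofReal (c ^ 3 * (c ^ 3 * (|Real.log α| / I θ)) ^ q) := by
      intro c hc
      filter_upwards [M.risk_T_le_of_div_abs_log W (hWb θ) (hI_pos θ) hA2 hq hqr ha hc,
        hka.eventually (gt_mem_nhds (hsub c hc))] with α hα hkα
      -- Here `ν e^{-a} ≤ k e^{-a}`, so one smallness condition covers every `ν ≤ k`.
      refine iSup₂_le fun ν hν => hα ν (le_trans ?_ hkα.le)
      gcongr
    refine ⟨RatioEquiv.of_bounds (hypos θ) (fun c hc => ?_) (fun c hc => ?_),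
      (RatioEquiv.of_bounds (hypos θ) (fun c hc => ?_) hup).inv (hne q θ)⟩
    · exact (hlow c hc).mono fun α hα => le_iInf₂ hα
    · filter_upwards [hup c hc, hPFA] with α hα hP
      exact (iInf₂_le (M.T W (a α)) ⟨M.isStoppingTime_T W _, hP⟩).trans hα
    · filter_upwards [hlow c hc, hPFA] with α hα hP
      exact hα _ ⟨M.isStoppingTime_T W _, hP⟩
  refine ⟨fun θ ν => ?_, fun a hPFA ha θ ν => ?_, fun k hk hαk => ⟨?_, hmini k hk⟩⟩
  · refine RatioEquiv.of_bounds (y := fun a => a / I θ)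
      ((eventually_gt_atTop 0).mono fun a ha => div_pos ha (hI_pos θ))
      (fun c hc => M.le_risk_T W hA1 (hI_pos θ) hq0 ν hc) (fun c hc => ?_)
    have hexp : Tendsto (fun a : ℝ => ν * Real.exp (-a)) atTop (𝓝 0) := by
      simpa using Real.tendsto_exp_neg_atTop_nhds_zero.const_mul (ν : ℝ)
    filter_upwards [M.risk_T_le W (hWb θ) (hI_pos θ) hA2 hq hqr hc,
      hexp.eventually (gt_mem_nhds (hsub c hc)), eventually_gt_atTop 0] with a ha hν ha0
    refine (ha ν hν.le).trans (ENNReal.ofReal_le_ofReal ?_)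
    have h2 : c ^ 2 ≤ c ^ 3 := pow_le_pow_right₀ hc.le (by norm_num)
    have hc0 : 0 < c := by linarith
    have := hI_pos θ
    gcongr
  · have hlow : ∀ c ∈ Set.Ioo (0 : ℝ) 1, ∀ᶠ α in 𝓝[>] (0 : ℝ), ∀ τ ∈ M.Delta α (ϱ α),
        ENNReal.ofReal (c ^ 3 * (c ^ 3 * (|Real.log α| / I θ)) ^ q) ≤ M.risk q ν θ τ :=
      fun c hc => M.le_risk_of_mem_Delta hA1 (hI_pos θ) hq0 ν hϱ hϱ_zero hc
    have hup : ∀ c : ℝ, 1 < c → ∀ᶠ α in 𝓝[>] (0 : ℝ), M.risk q ν θ (M.T W (a α)) ≤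
        ENNReal.ofReal (c ^ 3 * (c ^ 3 * (|Real.log α| / I θ)) ^ q) := by
      intro c hc
      have hexp : Tendsto (fun α => ν * Real.exp (-a α)) (𝓝[>] 0) (𝓝 0) := by
        simpa using (Real.tendsto_exp_neg_atTop_nhds_zero.comp
          (tendsto_atTop_of_div_abs_log ha)).const_mul (ν : ℝ)
      filter_upwards [M.risk_T_le_of_div_abs_log W (hWb θ) (hI_pos θ) hA2 hq hqr ha hc,
        hexp.eventually (gt_mem_nhds (hsub c hc))] with α hα hν
      exact hα ν hν.le
    refine ⟨RatioEquiv.of_bounds (hypos θ) (fun c hc => ?_) (fun c hc => ?_),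
      (RatioEquiv.of_bounds (hypos θ) (fun c hc => ?_) hup).inv (hne q θ)⟩
    · exact (hlow c hc).mono fun α hα => le_iInf₂ hα
    · filter_upwards [hup c hc, hPFA] with α hα hP
      exact (iInf₂_le (M.T W (a α)) ⟨M.isStoppingTime_T W _, hP⟩).trans hα
    · filter_upwards [hlow c hc, hPFA] with α hα hP
      exact hα _ ⟨M.isStoppingTime_T W _, hP⟩
  · refine hmini k hk _ ?_ ha₀ ?_
    · filter_upwards [Ioo_mem_nhdsGT (zero_lt_one (α := ℝ))] with α hα
      exact (hΔ₀ α hα).2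
    -- For the explicit threshold `k e^{-a} = α ϱ k / (1 - ϱ)`.
    · have h1 : Tendsto (fun α => 1 - ϱ α) (𝓝[>] 0) (𝓝 1) := by
        simpa using hϱ_zero.const_sub 1
      have h2 := hαk.div h1 one_ne_zero
      rw [zero_div] at h2
      refine h2.congr' ?_
      filter_upwards [Ioo_mem_nhdsGT (zero_lt_one (α := ℝ))] with α hα
      obtain ⟨hp0, hp1⟩ := hϱ α hα
      have hα0 := hα.1
      have hp1' : 0 < 1 - ϱ α := by linarith
      rw [Real.exp_neg, Real.exp_log (by positivity), Pi.div_apply, inv_div]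
      field_simp
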